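/- Let $x_+=\max(x,0)$ and let $\tau$ denote a standard Rayleigh random variable, with density $x e^{-x^2/2}$ on $(0,\infty)$. Let $R^F=(R^F_t)_{t\ge 0}$ and $R^B=(R^B_t)_{t\ge0}$ be the piecewise deterministic Markov processes on $\mathbb{R}$ with initial distribution $N(0,1)$ and extended generators $$L^Ff(x)=f'(x)+x_+\bigl(\mathbb{E}[f(-\tau)]-f(x)\bigr),\qquad L^Bf(x)=f'(x)+x_+\bigl(f(-x)-f(x)\bigr).$$ That is, both move with unit speed to the right and jump at rate $x_+$ when at $x$; at a jump $R^F$ moves to $-\tau$ with an independent copy of $\tau$, and $R^B$ moves from $x$ to $-x$. (These are the limiting radial momentum processes of Forward Event-Chain Monte Carlo and of the Bouncy Particle Sampler.) Let $K^F(t,s)=\operatorname{Cov}(R^F_t,R^F_s)$ and $K^B(t,s)=\operatorname{Cov}(R^B_t,R^B_s)$ be their covariance functions, and for $\rho>0$ put $$\sigma_F^2(\rho)=8\int_0^\infty e^{-\rho t}K^F(t,0)\,dt,\qquad \sigma_B^2(\rho)=8\int_0^\infty e^{-\rho t}K^B(t,0)\,dt .$$ Then $R^F_t$ and $R^B_t$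 are square integrable for every $t\ge 0$, both integrals converge absolutely for every $\rho>0$, and, as $\rho\searrow 0$, $$\sigma_F^2(\rho)\to\sqrt{\frac{32}{\pi}},\qquad \sigma_B^2(\rho)\to 0 .$$ -/

import Mathlib

open MeasureTheory ProbabilityTheory Filter Topology

noncomputable section

namespace RadialMomentum

/-- The standard Rayleigh distribution `χ(2)`, with density `x * exp (-x ^ 2 / 2)` on `(0, ∞)`. -/
def rayleigh : Measure ℝ :=
  (volume.restrict (Set.Ioi 0)).withDensity
    fun x : ℝ => ENNReal.ofReal (x * Real.exp (-x ^ 2 / 2))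

instance isProbabilityMeasure_rayleigh : IsProbabilityMeasure rayleigh := by
  constructor
  have hd : ∀ x ∈ Set.Ici (0 : ℝ), HasDerivAt (fun x : ℝ => -Real.exp (-x ^ 2 / 2))
      (x * Real.exp (-x ^ 2 / 2)) x := by
    intro x _
    have h1 : HasDerivAt (fun x : ℝ => -x ^ 2 / 2) (-x) x := by
      have := ((hasDerivAt_pow 2 x).neg).div_const 2
      convert! this using 1
      simp
      ring
    convert! h1.exp.neg using 1
    ring
  have ht : Tendsto (fun x : ℝ => -Real.exp (-x ^ 2 / 2)) atTop (𝓝 0) := by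
    rw [← neg_zero]
    refine Tendsto.neg (Real.tendsto_exp_atBot.comp ?_)
    have h2 : Tendsto (fun x : ℝ => x ^ 2 / 2) atTop atTop :=
      (tendsto_pow_atTop two_ne_zero).atTop_div_const two_pos
    refine (tendsto_neg_atTop_atBot.comp h2).congr fun x => ?_
    simp only [Function.comp_apply]
    ring
  have hn : ∀ x ∈ Set.Ioi (0 : ℝ), 0 ≤ x * Real.exp (-x ^ 2 / 2) :=
    fun x hx => mul_nonneg (le_of_lt hx) (Real.exp_pos _).le
  have hi := integrableOn_Ioi_deriv_of_nonneg' hd hn ht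
  have hv := integral_Ioi_of_hasDerivAt_of_nonneg' hd hn ht
  rw [rayleigh, withDensity_apply _ MeasurableSet.univ, Measure.restrict_univ,
    ← ofReal_integral_eq_lintegral_ofReal hi (ae_restrict_of_forall_mem measurableSet_Ioi hn), hv]
  simp

/-! ### One-dimensional piecewise deterministic processes

Both radial momentum processes move with unit speed, jump at rate `x₊` when at `x`, and at a jump
the pre-jump location `x` is replaced by `J x m`, where `m` is an independent standard Rayleigh
mark. This is the process with extended generator `L f x = f' x + x₊ * (E[f (J x m)] - f x)`. It is
built jump by jump from its initial value and an i.i.d. sequence of pairs: a standard exponential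
clock and a Rayleigh mark for each jump. -/

/-- The jump rate `x₊ = max x 0`. -/
def rate (x : ℝ) : ℝ := max x 0

/-- The waiting time until the next jump, starting from the location `x`, with exponential clock
`e`: the first time at which the rate accumulated along the unit speed flow reaches `e`. For a
standard exponential `e` it exceeds `t` with probability `exp (-∫ s in 0..t, rate (x + s))`. -/
def waitingTime (x e : ℝ) : ℝ :=
  sInf {t : ℝ | 0 ≤ t ∧ e ≤ ∫ s in (0 : ℝ)..t, rate (x + s)}

/-- The pair formed by the time of the `n`-th jump and the location just after it (the initial
time and location if `n = 0`), for the jump map `J`, the initial location `x`, and the sequence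
`ξ` of pairs (exponential clock, mark). -/
def skeleton (J : ℝ → ℝ → ℝ) (x : ℝ) (ξ : ℕ → ℝ × ℝ) : ℕ → ℝ × ℝ
  | 0 => (0, x)
  | n + 1 =>
    let S := (skeleton J x ξ n).1
    let Z := (skeleton J x ξ n).2
    let T := waitingTime Z (ξ n).1
    (S + T, J (Z + T) (ξ n).2)

/-- The sample space: an initial location, and a sequence of pairs (exponential clock, mark). -/
abbrev Ω : Type := ℝ × (ℕ → ℝ × ℝ)

/-- The location at time `t`: if the `n`-th jump time `S n` and the next one satisfy
`S n ≤ t < S (n + 1)`, then it is `Z n + (t - S n)`, where `Z n` is the location just after the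
`n`-th jump. (At most one summand is nonzero.) -/
def process (J : ℝ → ℝ → ℝ) (t : ℝ) (ω : Ω) : ℝ :=
  ∑' n : ℕ, (Set.Ico (skeleton J ω.1 ω.2 n).1 (skeleton J ω.1 ω.2 (n + 1)).1).indicator
    (fun u => (skeleton J ω.1 ω.2 n).2 + (u - (skeleton J ω.1 ω.2 n).1)) t

/-- The law of one pair (exponential clock, mark). -/
def noise : Measure (ℝ × ℝ) := (expMeasure 1).prod rayleigh

instance isProbabilityMeasure_noise : IsProbabilityMeasure noise := by
  have := isProbabilityMeasure_expMeasure one_pos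
  unfold noise
  infer_instance

/-- The underlying probability: a standard Gaussian initial location (the stationary start), and
independently of it i.i.d. pairs (exponential clock, mark). -/
def prob : Measure Ω := (gaussianReal 0 1).prod (Measure.infinitePi fun _ : ℕ => noise)

instance isProbabilityMeasure_prob : IsProbabilityMeasure prob := by
  unfold prob
  infer_instance

/-- The limiting radial momentum process `R^F` of Forward Event-Chain Monte Carlo: a jump leads to
`-τ` with `τ` standard Rayleigh, so that `L f x = f' x + x₊ * (E[f (-τ)] - f x)`. -/
def RF : ℝ → Ω → ℝ := process fun _ m => -m

/-- The limiting radial momentum process `R^B` of the Bouncy Particle Sampler: a jump leads from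
`x` to `-x`, so that `L f x = f' x + x₊ * (f (-x) - f x)`. -/
def RB : ℝ → Ω → ℝ := process fun x _ => -x

/-- The covariance function `K t s = Cov (R t, R s)`. -/
def covFun (R : ℝ → Ω → ℝ) (t s : ℝ) : ℝ := cov[R t, R s; prob]

/-- The Green-Kubo integral `8 * ∫₀^∞ exp (-ρ t) K(t, 0) dt`. -/
def diffusivity (R : ℝ → Ω → ℝ) (ρ : ℝ) : ℝ :=
  8 * ∫ t in Set.Ioi (0 : ℝ), Real.exp (-ρ * t) * covFun R t 0

/-- `σ_F²(ρ)`, for `ρ > 0`. -/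
def sigmaFSq (ρ : ℝ) : ℝ := diffusivity RF ρ

/-- `σ_B²(ρ)`, for `ρ > 0`. -/
def sigmaBSq (ρ : ℝ) : ℝ := diffusivity RB ρ

end RadialMomentum

end

noncomputable section

namespace RadialMomentum

section

/-! ### The waiting time -/

/-! Integrate `exp (-ρ t) R_t R_0` stage by stage, a stage being the interval between consecutive
jumps (`hasSum_stageValue`). With clock `e`, a stage started at `z` ends at the peak `√(z₊² + 2e)`.
Every jump lands at a nonpositive location, from which the next peak `√(2e)` no longer depends on
the landing point. Hence the process regenerates, and the terms from the third stage on form a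
geometric series (`integral_stageValue_add_two`, `diffusivity_process`): `E[x exp (-ρ(c - x))] * (1
- β)⁻¹ * A`, where `x` is the initial location, `c` the first `cycle`, `β` the expected discount
over a cycle and `A` the discounted contribution of one regenerated stage.

As `ρ ↘ 0`, the first factor is `O(ρ)` because `E[x] = 0` (`abs_integral_mul_exp_le`), `1 - β` is at
least of order `ρ` (`exists_mul_le_one_sub_cycleDiscount`), and `A → 0` (`tendsto_landedValue`): an
undiscounted stage contributes `(peak² - z²) / 2`, with mean `1 - E[z²] / 2` over landing points
`z`, and both jump maps have `E[z²] = 2`. So the series vanishes in the limit and only two stages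
matter (`tendsto_diffusivity_process`).

The initial stage gives `E[x x₊²] / 2 = 1 / √(2π)` for both processes. The next gives `E[x (1 -
z²/2)]`, with `z` the first landing point. For `R^F`, `z` is independent of `x` and this is `0`; for
`R^B`, `z² = x₊² + 2e` and it is `-1 / √(2π)`. Multiplying by `8` yields the two limits. -/

lemma hasDerivAt_max_zero_sq (u : ℝ) :
    HasDerivAt (fun v : ℝ => (max v 0) ^ 2 / 2) (max u 0) u := by
  rcases lt_trichotomy u 0 with hu | rfl | hu
  · rw [max_eq_right hu.le]
    refine (hasDerivAt_const u (0 : ℝ)).congr_of_eventuallyEq ?_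
    filter_upwards [Iio_mem_nhds hu] with v hv
    simp [max_eq_right (le_of_lt (Set.mem_Iio.1 hv))]
  -- At the kink the function is dominated by `v²`, so its derivative is `0`.
  · rw [max_self, hasDerivAt_iff_isLittleO]
    have h : (fun v : ℝ => v ^ 2) =o[𝓝 0] fun v => v - 0 := by
      simpa using (Asymptotics.isLittleO_pow_id one_lt_two : (fun v : ℝ => v ^ 2) =o[𝓝 0] id)
    refine Asymptotics.IsBigO.trans_isLittleO (Asymptotics.IsBigO.of_bound 1 ?_) h
    refine Eventually.of_forall fun v => ?_
    simp only [max_self, sub_zero, smul_zero, Real.norm_eq_abs, one_mul, ne_eq,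
      OfNat.ofNat_ne_zero, not_false_eq_true, zero_pow, zero_div]
    rcases le_total v 0 with hv | hv
    · simp [hv, sq_nonneg]
    · rw [max_eq_left hv, abs_of_nonneg (by positivity), abs_of_nonneg (by positivity)]
      nlinarith [sq_nonneg v]
  · rw [max_eq_left hu.le]
    have h : HasDerivAt (fun v : ℝ => v ^ 2 / 2) u u := by
      convert! (hasDerivAt_pow 2 u).div_const 2 using 1
      simp
    refine h.congr_of_eventuallyEq ?_
    filter_upwards [Ioi_mem_nhds hu] with v hv
    rw [max_eq_left (le_of_lt hv)]

lemma integral_rate (x t : ℝ) :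
    ∫ s in (0 : ℝ)..t, rate (x + s) = ((max (x + t) 0) ^ 2 - (max x 0) ^ 2) / 2 := by
  have h := intervalIntegral.integral_eq_sub_of_hasDerivAt (a := x + 0) (b := x + t)
    (fun u _ => hasDerivAt_max_zero_sq u)
    ((continuous_id.max continuous_const).intervalIntegrable _ _)
  rw [intervalIntegral.integral_comp_add_left (fun u => rate u)]
  simp only [rate]
  rw [h, add_zero]
  ring

/-- The location just before the first jump, if the clock `e` is positive. -/
def peak (x e : ℝ) : ℝ := Real.sqrt ((max x 0) ^ 2 + 2 * e)

lemma le_peak (x : ℝ) {e : ℝ} (he : 0 ≤ e) : x ≤ peak x e :=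
  (le_max_left x 0).trans (Real.le_sqrt_of_sq_le (by linarith))

lemma peak_pos (x : ℝ) {e : ℝ} (he : 0 < e) : 0 < peak x e :=
  Real.sqrt_pos.2 (by positivity)

lemma peak_nonneg (x e : ℝ) : 0 ≤ peak x e := Real.sqrt_nonneg _

/-- The source of regeneration: no rate accumulates below `0`, so the peak forgets a nonpositive
start. -/
lemma peak_of_nonpos {x : ℝ} (hx : x ≤ 0) (e : ℝ) : peak x e = Real.sqrt (2 * e) := by
  simp [peak, hx]

lemma sq_peak (x : ℝ) {e : ℝ} (he : 0 ≤ e) : peak x e ^ 2 = (max x 0) ^ 2 + 2 * e :=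
  Real.sq_sqrt (by positivity)

/-- The accumulated rate reaches `e` when `(x + t)₊²` reaches `peak²`. Positivity of `e` matters:
for `e = 0` and `x < 0` the infimum is `0`, not `-x`. -/
lemma waitingTime_of_pos (x : ℝ) {e : ℝ} (he : 0 < e) : waitingTime x e = peak x e - x := by
  have h : {t : ℝ | 0 ≤ t ∧ e ≤ ∫ s in (0 : ℝ)..t, rate (x + s)} = Set.Ici (peak x e - x) := by
    ext t
    rw [Set.mem_ofPred_eq, integral_rate, Set.mem_Ici]
    have hp := peak_pos x he
    have hsq := sq_peak x he.le
    have hle := le_peak x he.le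
    constructor
    · rintro ⟨_, h⟩
      by_contra! hlt
      have : max (x + t) 0 < peak x e := max_lt (by linarith) hp
      nlinarith [le_max_right (x + t) 0]
    · intro h
      refine ⟨by linarith, ?_⟩
      have : peak x e ≤ max (x + t) 0 := le_max_of_le_left (by linarith)
      nlinarith
  rw [waitingTime, h, csInf_Ici]

lemma waitingTime_of_nonpos (x : ℝ) {e : ℝ} (he : e ≤ 0) : waitingTime x e = 0 := by
  have h : {t : ℝ | 0 ≤ t ∧ e ≤ ∫ s in (0 : ℝ)..t, rate (x + s)} = Set.Ici 0 := by
    ext t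
    simp only [Set.mem_ofPred_eq, Set.mem_Ici, and_iff_left_iff_imp]
    exact fun ht => he.trans (intervalIntegral.integral_nonneg ht fun s _ => le_max_right _ _)
  rw [waitingTime, h, csInf_Ici]

lemma waitingTime_nonneg (x e : ℝ) : 0 ≤ waitingTime x e :=
  Real.sInf_nonneg fun _ ht => ht.1

lemma measurable_waitingTime : Measurable fun p : ℝ × ℝ => waitingTime p.1 p.2 := by
  have h : (fun p : ℝ × ℝ => waitingTime p.1 p.2) =
      fun p => if 0 < p.2 then peak p.1 p.2 - p.1 else 0 := by
    ext p
    split_ifs with hp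
    · exact waitingTime_of_pos _ hp
    · exact waitingTime_of_nonpos _ (not_lt.1 hp)
  rw [h]
  unfold peak
  exact Measurable.ite (measurableSet_lt measurable_const measurable_snd) (by fun_prop)
    measurable_const

/-! ### The skeleton -/

/-- The sequence with first entry `p.1`, followed by the sequence `p.2`. -/
def consEquiv : (ℝ × ℝ) × (ℕ → ℝ × ℝ) ≃ᵐ (ℕ → ℝ × ℝ) where
  toFun p n := Nat.casesOn n p.1 p.2
  invFun ξ := (ξ 0, fun n => ξ (n + 1))
  left_inv _ := rfl
  right_inv ξ := by
    ext n : 1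
    cases n <;> rfl
  measurable_toFun := by
    refine measurable_pi_lambda _ fun n => ?_
    cases n with
    | zero => exact measurable_fst
    | succ n => exact (measurable_pi_apply n).comp measurable_snd
  measurable_invFun := by
    refine Measurable.prodMk (measurable_pi_apply 0) ?_
    exact measurable_pi_lambda _ fun n => measurable_pi_apply (n + 1)

@[simp] lemma consEquiv_zero (p : (ℝ × ℝ) × (ℕ → ℝ × ℝ)) : consEquiv p 0 = p.1 := rfl

@[simp] lemma consEquiv_succ (p : (ℝ × ℝ) × (ℕ → ℝ × ℝ)) (n : ℕ) :
    consEquiv p (n + 1) = p.2 n := rfl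

/-- The law of an i.i.d. sequence of pairs (exponential clock, mark). -/
def noiseSeq : Measure (ℕ → ℝ × ℝ) := Measure.infinitePi fun _ : ℕ => noise

instance isProbabilityMeasure_noiseSeq : IsProbabilityMeasure noiseSeq := by
  unfold noiseSeq
  infer_instance

lemma prob_eq : prob = (gaussianReal 0 1).prod noiseSeq := rfl

lemma measurePreserving_consEquiv :
    MeasurePreserving consEquiv (noise.prod noiseSeq) noiseSeq := by
  refine ⟨consEquiv.measurable, Measure.eq_infinitePi _ fun s t ht => ?_⟩
  classical
  have hbig : ∀ s : Finset ℕ, (∀ i, MeasurableSet (if i ∈ s then t i else Set.univ)) := by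
    intro s i
    split_ifs
    exacts [ht i, .univ]
  -- Boxes determine the product measure. Padding the box with `univ` to an initial segment makes it
  -- split as coordinate `0` times a shifted box.
  obtain ⟨N, hN⟩ : ∃ N : ℕ, s ⊆ Finset.range (N + 1) :=
    ⟨s.sup id, fun i hi => Finset.mem_range.2 (Nat.lt_succ_of_le (Finset.le_sup (f := id) hi))⟩
  set u : ℕ → Set (ℝ × ℝ) := fun i => if i ∈ s then t i else Set.univ with hu
  have hpi : Set.pi (s : Set ℕ) t = Set.pi (Finset.range (N + 1) : Set ℕ) u := by
    ext ξ
    simp only [Set.mem_pi, hu, Finset.mem_coe]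
    constructor
    · intro h i _
      split_ifs with hi
      exacts [h i hi, Set.mem_univ _]
    · intro h i hi
      simpa [hi] using h i (hN hi)
  have hpre : consEquiv ⁻¹' Set.pi (Finset.range (N + 1) : Set ℕ) u =
      u 0 ×ˢ Set.pi (Finset.range N : Set ℕ) fun i => u (i + 1) := by
    ext p
    simp only [Set.mem_preimage, Set.mem_pi, Finset.mem_coe, Finset.mem_range, Set.mem_prod]
    constructor
    · exact fun h => ⟨h 0 (by omega), fun i hi => h (i + 1) (by omega)⟩
    · rintro ⟨h0, h⟩ (_ | i) hi
      exacts [h0, h i (by omega)]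
  rw [hpi, Measure.map_apply consEquiv.measurable
    (MeasurableSet.pi (Finset.countable_toSet _) fun i _ => hbig s i), hpre, Measure.prod_prod,
    noiseSeq, Measure.infinitePi_pi _ fun i _ => hbig s (i + 1), mul_comm,
    ← Finset.prod_range_succ' (fun i => noise (u i)), ← Finset.prod_subset hN]
  · exact Finset.prod_congr rfl fun i hi => by simp [hu, hi]
  · intro i _ hi
    simp [hu, hi]

variable {J : ℝ → ℝ → ℝ}

/-- First-step decomposition: `skeleton` recurses on its last jump, while the renewal argument
conditions on the first. -/
lemma skeleton_cons (x : ℝ) (p : ℝ × ℝ) (ξ : ℕ → ℝ × ℝ) (n : ℕ) :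
    skeleton J x (consEquiv (p, ξ)) (n + 1) =
      (waitingTime x p.1 + (skeleton J (J (x + waitingTime x p.1) p.2) ξ n).1,
        (skeleton J (J (x + waitingTime x p.1) p.2) ξ n).2) := by
  induction n with
  | zero => simp [skeleton]
  | succ n ih =>
    rw [skeleton, ih]
    simp [skeleton, add_assoc]

lemma measurable_skeleton (hJ : Measurable (Function.uncurry J)) (n : ℕ) :
    Measurable fun ω : Ω => skeleton J ω.1 ω.2 n := by
  induction n with
  | zero => exact measurable_const.prodMk measurable_fst
  | succ n ih =>
    have hξ : Measurable fun ω : Ω => ω.2 n := (measurable_pi_apply n).comp measurable_snd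
    have hT : Measurable fun ω : Ω => waitingTime (skeleton J ω.1 ω.2 n).2 (ω.2 n).1 :=
      measurable_waitingTime.comp (ih.snd.prodMk hξ.fst)
    exact (ih.fst.add hT).prodMk (hJ.comp ((ih.snd.add hT).prodMk hξ.snd))

lemma skeleton_succ_fst (x : ℝ) (ξ : ℕ → ℝ × ℝ) (n : ℕ) :
    (skeleton J x ξ (n + 1)).1 =
      (skeleton J x ξ n).1 + waitingTime (skeleton J x ξ n).2 (ξ n).1 := rfl

lemma monotone_skeleton_fst (x : ℝ) (ξ : ℕ → ℝ × ℝ) :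
    Monotone fun n => (skeleton J x ξ n).1 :=
  monotone_nat_of_le_succ fun n => by
    rw [skeleton_succ_fst]
    linarith [waitingTime_nonneg (skeleton J x ξ n).2 (ξ n).1]

lemma skeleton_fst_nonneg (x : ℝ) (ξ : ℕ → ℝ × ℝ) (n : ℕ) : 0 ≤ (skeleton J x ξ n).1 :=
  monotone_skeleton_fst x ξ (Nat.zero_le n)

/-! ### Stages and measurability of the process. -/

/-- The pairs (time, sample point) at which exactly `n` jumps have occurred. -/
def stage (J : ℝ → ℝ → ℝ) (n : ℕ) : Set (ℝ × Ω) :=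
  {p | p.1 ∈ Set.Ico (skeleton J p.2.1 p.2.2 n).1 (skeleton J p.2.1 p.2.2 (n + 1)).1}

lemma measurableSet_stage (hJ : Measurable (Function.uncurry J)) (n : ℕ) :
    MeasurableSet (stage J n) :=
  (measurableSet_le ((measurable_skeleton hJ n).fst.comp measurable_snd) measurable_fst).inter
    (measurableSet_lt measurable_fst ((measurable_skeleton hJ (n + 1)).fst.comp measurable_snd))

lemma pairwise_disjoint_stage : Pairwise (Function.onFun Disjoint (stage J)) := by
  intro m n hmn
  refine Set.disjoint_left.2 fun p hm hn => ?_
  exact Set.disjoint_left.1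
    ((monotone_skeleton_fst p.2.1 p.2.2).pairwise_disjoint_on_Ico_succ hmn) hm hn

lemma process_of_mem_stage {n : ℕ} {t : ℝ} {ω : Ω} (h : (t, ω) ∈ stage J n) :
    process J t ω = (skeleton J ω.1 ω.2 n).2 + (t - (skeleton J ω.1 ω.2 n).1) := by
  rw [process, tsum_eq_single n]
  · exact Set.indicator_of_mem (show t ∈ Set.Ico _ _ from h) _
  intro m hm
  refine Set.indicator_of_notMem (fun hm' => ?_) _
  exact Set.disjoint_left.1 (pairwise_disjoint_stage hm) (show (t, ω) ∈ stage J m from hm') h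

/-- For `t ≥ 0` this is the case of infinitely many jumps up to time `t`. The default value `0`
satisfies all later bounds, so non-explosion need not be proved. -/
lemma process_of_notMem_stage {t : ℝ} {ω : Ω} (h : ∀ n, (t, ω) ∉ stage J n) :
    process J t ω = 0 := by
  rw [process]
  exact (tsum_congr fun n => Set.indicator_of_notMem (show t ∉ Set.Ico _ _ from h n) _).trans
    tsum_zero

lemma measurable_process (hJ : Measurable (Function.uncurry J)) :
    Measurable fun p : ℝ × Ω => process J p.1 p.2 := by
  have h : ∀ n, Measurable ((stage J n).indicator fun p : ℝ × Ω =>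
      (skeleton J p.2.1 p.2.2 n).2 + (p.1 - (skeleton J p.2.1 p.2.2 n).1)) := fun n =>
    Measurable.indicator (((measurable_skeleton hJ n).snd.comp measurable_snd).add
      (measurable_fst.sub ((measurable_skeleton hJ n).fst.comp measurable_snd)))
      (measurableSet_stage hJ n)
  refine measurable_of_tendsto_metrizable (f := fun N p => ∑ n ∈ Finset.range N, (stage J n).indicator
    (fun p : ℝ × Ω => (skeleton J p.2.1 p.2.2 n).2 + (p.1 - (skeleton J p.2.1 p.2.2 n).1)) p)
    (fun N => Finset.measurable_fun_sum _ fun n _ => h n) ?_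
  refine tendsto_pi_nhds.2 fun p => tendsto_const_nhds.congr' ?_
  by_cases hp : ∃ n, p ∈ stage J n
  · obtain ⟨n, hn⟩ := hp
    filter_upwards [eventually_gt_atTop n] with N hN
    rw [process_of_mem_stage hn, Finset.sum_eq_single_of_mem n (Finset.mem_range.2 hN),
      Set.indicator_of_mem hn]
    intro m _ hm
    exact Set.indicator_of_notMem
      (fun hm' => Set.disjoint_left.1 (pairwise_disjoint_stage hm) hm' hn) _
  · push Not at hp
    refine Eventually.of_forall fun N => ?_
    rw [process_of_notMem_stage hp]
    exact (Finset.sum_eq_zero fun n _ => Set.indicator_of_notMem (hp n) _).symm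

end

section

/-! ### The renewal structure -/

lemma integral_pos_of_ae_pos {α : Type*} [MeasurableSpace α] {μ : Measure α} [NeZero μ]
    {f : α → ℝ} (hi : Integrable f μ) (hf : ∀ᵐ x ∂μ, 0 < f x) : 0 < ∫ x, f x ∂μ := by
  have h0 : 0 ≤ᵐ[μ] f := hf.mono fun x hx => hx.le
  refine lt_of_le_of_ne (integral_nonneg_of_ae h0) fun h => ?_
  obtain ⟨x, hx, hx'⟩ := (hf.and ((integral_eq_zero_iff_of_nonneg_ae h0 hi).1 h.symm)).exists
  exact hx.ne' hx'

lemma ae_expMeasure_pos : ∀ᵐ e ∂expMeasure 1, 0 < e := by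
  have h : ∀ᵐ e ∂volume.withDensity (gammaPDF 1 1), 0 < e := by
    -- The density does not vanish at `0`, so that point is discarded as a Lebesgue null set.
    have hm : Measurable (gammaPDF 1 1) := (measurable_gammaPDFReal 1 1).ennreal_ofReal
    rw [ae_withDensity_iff hm]
    filter_upwards [compl_mem_ae_iff.2 (Real.volume_singleton (a := 0))] with e he h0
    by_contra! hle
    exact h0 (gammaPDF_of_neg (lt_of_le_of_ne hle he))
  exact h

lemma ae_rayleigh_pos : ∀ᵐ m ∂rayleigh, 0 < m :=
  (withDensity_absolutelyContinuous _ _).ae_le (ae_restrict_mem measurableSet_Ioi)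

lemma ae_noise_pos : ∀ᵐ p ∂noise, 0 < p.1 ∧ 0 < p.2 := by
  have := isProbabilityMeasure_expMeasure one_pos
  exact (Measure.quasiMeasurePreserving_fst.ae ae_expMeasure_pos).and
    (Measure.quasiMeasurePreserving_snd.ae ae_rayleigh_pos)

/-- The location just after the first jump, starting from `x`. -/
def landing (J : ℝ → ℝ → ℝ) (x : ℝ) (p : ℝ × ℝ) : ℝ := J (peak x p.1) p.2

/-- The time the process spends at positive locations up to the first jump and at negative
locations after it, starting from `0`. Started from `x`, it takes `cycle J x p - x` to return
to `0` after the first jump. -/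
def cycle (J : ℝ → ℝ → ℝ) (x : ℝ) (p : ℝ × ℝ) : ℝ := peak x p.1 - landing J x p

/-- The expected discount over a cycle. -/
def cycleDiscount (J : ℝ → ℝ → ℝ) (θ : ℝ) : ℝ := ∫ p, Real.exp (-θ * cycle J 0 p) ∂noise

/-- A function `h` of the location after the `n`-th jump and of the next pair (clock, mark),
discounted to time `0`. -/
def stageValue (J : ℝ → ℝ → ℝ) (θ : ℝ) (h : ℝ → ℝ × ℝ → ℝ) (n : ℕ) (ω : Ω) : ℝ :=
  Real.exp (-θ * (skeleton J ω.1 ω.2 n).1) * h (skeleton J ω.1 ω.2 n).2 (ω.2 n)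

/-- The value `stageValue` of the process started at `0`, counting its jumps from the first one. -/
def landedValue (J : ℝ → ℝ → ℝ) (θ : ℝ) (h : ℝ → ℝ × ℝ → ℝ) (n : ℕ)
    (q : (ℝ × ℝ) × (ℕ → ℝ × ℝ)) : ℝ :=
  Real.exp (-θ * peak 0 q.1.1) * stageValue J θ h n (landing J 0 q.1, q.2)

variable {J : ℝ → ℝ → ℝ} {θ : ℝ} {h : ℝ → ℝ × ℝ → ℝ}

lemma measurable_peak : Measurable fun p : ℝ × ℝ => peak p.1 p.2 := by
  unfold peak
  fun_prop

lemma measurable_landing (hJ : Measurable (Function.uncurry J)) :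
    Measurable fun q : ℝ × (ℝ × ℝ) => landing J q.1 q.2 :=
  hJ.comp ((measurable_peak.comp (measurable_fst.prodMk measurable_snd.fst)).prodMk
    measurable_snd.snd)

lemma landing_of_nonpos {z : ℝ} (hz : z ≤ 0) (p : ℝ × ℝ) :
    landing J z p = landing J 0 p := by
  simp only [landing, peak_of_nonpos hz, peak_of_nonpos le_rfl]

lemma measurable_cycle (hJ : Measurable (Function.uncurry J)) :
    Measurable fun q : ℝ × (ℝ × ℝ) => cycle J q.1 q.2 :=
  (measurable_peak.comp (measurable_fst.prodMk measurable_snd.fst)).sub (measurable_landing hJ)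

lemma measurable_stageValue (hJ : Measurable (Function.uncurry J))
    (hh : Measurable (Function.uncurry h)) (n : ℕ) : Measurable (stageValue J θ h n) :=
  ((measurable_skeleton hJ n).fst.const_mul _).exp.mul
    (hh.comp ((measurable_skeleton hJ n).snd.prodMk ((measurable_pi_apply n).comp measurable_snd)))

lemma measurable_landedValue (hJ : Measurable (Function.uncurry J))
    (hh : Measurable (Function.uncurry h)) (n : ℕ) : Measurable (landedValue J θ h n) :=
  ((measurable_peak.comp (measurable_const.prodMk measurable_fst.fst)).const_mul _).exp.mul
    ((measurable_stageValue hJ hh n).comp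
      (((measurable_landing hJ).comp (measurable_const.prodMk measurable_fst)).prodMk
        measurable_snd))

lemma stageValue_cons (n : ℕ) (x : ℝ) {p : ℝ × ℝ} (hp : 0 < p.1) (ξ : ℕ → ℝ × ℝ) :
    stageValue J θ h (n + 1) (x, consEquiv (p, ξ)) =
      Real.exp (-θ * (peak x p.1 - x)) * stageValue J θ h n (landing J x p, ξ) := by
  simp only [stageValue, skeleton_cons, waitingTime_of_pos x hp, consEquiv_succ, landing,
    add_sub_cancel, mul_add, Real.exp_add, mul_assoc]

/-- The first two waiting times add up to `(cycle J x p - x) + peak 0 p'.1`. This separates `(x, p)`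
from `(p', ξ)`; two jumps are needed since the first peak may still depend on `x`. -/
lemma stageValue_cons_cons (n : ℕ) (x : ℝ) {p p' : ℝ × ℝ} (hp : 0 < p.1) (hp' : 0 < p'.1)
    (hx : landing J x p ≤ 0) (ξ : ℕ → ℝ × ℝ) :
    stageValue J θ h (n + 2) (x, consEquiv (p, consEquiv (p', ξ))) =
      Real.exp (-θ * (cycle J x p - x)) * landedValue J θ h n (p', ξ) := by
  have h1 : peak (landing J x p) p'.1 = peak 0 p'.1 := by
    rw [peak_of_nonpos hx, peak_of_nonpos le_rfl]
  have h2 := landing_of_nonpos (J := J) hx p'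
  rw [stageValue_cons _ _ hp, stageValue_cons _ _ hp', h2, h1, landedValue, ← mul_assoc,
    ← mul_assoc, ← Real.exp_add, ← Real.exp_add]
  congr 2
  rw [cycle]
  ring

lemma landedValue_succ (n : ℕ) {p p' : ℝ × ℝ} (hp' : 0 < p'.1)
    (hx : landing J 0 p ≤ 0) (ξ : ℕ → ℝ × ℝ) :
    landedValue J θ h (n + 1) (p, consEquiv (p', ξ)) =
      Real.exp (-θ * cycle J 0 p) * landedValue J θ h n (p', ξ) := by
  have h1 : peak (landing J 0 p) p'.1 = peak 0 p'.1 := by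
    rw [peak_of_nonpos hx, peak_of_nonpos le_rfl]
  have h2 := landing_of_nonpos (J := J) hx p'
  rw [landedValue, stageValue_cons _ _ hp', h2, h1, landedValue, ← mul_assoc,
    ← mul_assoc, ← Real.exp_add, ← Real.exp_add]
  congr 2
  rw [cycle]
  ring

/-! ### Splitting the noise into independent pieces. -/

/-- Splitting off the first pair (clock, mark) of the sequence. -/
def splitEquiv : (ℝ × (ℝ × ℝ)) × (ℕ → ℝ × ℝ) ≃ᵐ Ω :=
  MeasurableEquiv.prodAssoc.trans (MeasurableEquiv.prodCongr (MeasurableEquiv.refl ℝ) consEquiv)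

@[simp] lemma splitEquiv_apply (q : (ℝ × (ℝ × ℝ)) × (ℕ → ℝ × ℝ)) :
    splitEquiv q = (q.1.1, consEquiv (q.1.2, q.2)) := rfl

/-- The law of the initial location and the first pair (clock, mark). -/
def initialLaw : Measure (ℝ × (ℝ × ℝ)) := (gaussianReal 0 1).prod noise

instance isProbabilityMeasure_initialLaw : IsProbabilityMeasure initialLaw := by
  unfold initialLaw
  infer_instance

lemma measurePreserving_splitEquiv :
    MeasurePreserving splitEquiv (initialLaw.prod noiseSeq) prob := by
  have h1 := measurePreserving_prodAssoc (gaussianReal 0 1) noise noiseSeq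
  have h2 := (MeasurePreserving.id (gaussianReal 0 1)).prod measurePreserving_consEquiv
  exact h2.comp h1

/-- Splitting off the first pair (clock, mark) of the sequence. -/
def consRight (α : Type*) [MeasurableSpace α] :
    α × ((ℝ × ℝ) × (ℕ → ℝ × ℝ)) ≃ᵐ α × (ℕ → ℝ × ℝ) :=
  MeasurableEquiv.prodCongr (MeasurableEquiv.refl α) consEquiv

@[simp] lemma consRight_apply {α : Type*} [MeasurableSpace α]
    (q : α × ((ℝ × ℝ) × (ℕ → ℝ × ℝ))) : consRight α q = (q.1, consEquiv q.2) := rfl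

lemma measurePreserving_consRight {α : Type*} [MeasurableSpace α] (μ : Measure α)
    [SFinite μ] : MeasurePreserving (consRight α) (μ.prod (noise.prod noiseSeq))
      (μ.prod noiseSeq) :=
  (MeasurePreserving.id μ).prod measurePreserving_consEquiv

lemma ae_initialLaw_pos : ∀ᵐ q ∂initialLaw, 0 < q.2.1 ∧ 0 < q.2.2 :=
  Measure.quasiMeasurePreserving_snd.ae ae_noise_pos

lemma cycleDiscount_nonneg : 0 ≤ cycleDiscount J θ :=
  integral_nonneg fun _ => (Real.exp_pos _).le

/-! ### Factorization over cycles for jumps to the nonpositive half-line. -/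

variable (hneg : ∀ y m : ℝ, 0 < y → 0 < m → J y m ≤ 0)
include hneg

lemma landing_nonpos (x : ℝ) {p : ℝ × ℝ} (hp : 0 < p.1 ∧ 0 < p.2) : landing J x p ≤ 0 :=
  hneg _ _ (peak_pos x hp.1) hp.2

lemma cycle_pos (x : ℝ) {p : ℝ × ℝ} (hp : 0 < p.1 ∧ 0 < p.2) : 0 < cycle J x p := by
  have := landing_nonpos hneg x hp
  have := peak_pos x hp.1
  rw [cycle]
  linarith

lemma cycle_sub_nonneg (x : ℝ) {p : ℝ × ℝ} (hp : 0 < p.1 ∧ 0 < p.2) : 0 ≤ cycle J x p - x := by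
  have := landing_nonpos hneg x hp
  have := le_peak x hp.1.le
  rw [cycle]
  linarith

lemma ae_landedValue_succ (n : ℕ) :
    ∀ᵐ q ∂noise.prod (noise.prod noiseSeq), landedValue J θ h (n + 1) (consRight _ q) =
      Real.exp (-θ * cycle J 0 q.1) * landedValue J θ h n q.2 := by
  filter_upwards [Measure.quasiMeasurePreserving_fst.ae ae_noise_pos,
    Measure.quasiMeasurePreserving_snd.ae (Measure.quasiMeasurePreserving_fst.ae ae_noise_pos)]
    with q hq hq'
  exact landedValue_succ n hq'.1 (landing_nonpos hneg 0 hq) q.2.2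

lemma ae_stageValue_add_two (n : ℕ) :
    ∀ᵐ q ∂initialLaw.prod (noise.prod noiseSeq),
      stageValue J θ h (n + 2) (splitEquiv (consRight _ q)) =
      Real.exp (-θ * (cycle J q.1.1 q.1.2 - q.1.1)) * landedValue J θ h n q.2 := by
  filter_upwards [Measure.quasiMeasurePreserving_fst.ae ae_initialLaw_pos,
    Measure.quasiMeasurePreserving_snd.ae (Measure.quasiMeasurePreserving_fst.ae ae_noise_pos)]
    with q hq hq'
  exact stageValue_cons_cons n q.1.1 hq.1 hq'.1 (landing_nonpos hneg _ hq) q.2.2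

/-- Each cycle started from `0` is independent of the later noise and contributes one factor
`cycleDiscount`. -/
lemma integral_landedValue (n : ℕ) :
    ∫ q, landedValue J θ h n q ∂noise.prod noiseSeq =
      cycleDiscount J θ ^ n * ∫ q, landedValue J θ h 0 q ∂noise.prod noiseSeq := by
  induction n with
  | zero => simp
  | succ n ih =>
    rw [← (measurePreserving_consRight noise).integral_comp (consRight _).measurableEmbedding,
      integral_congr_ae (ae_landedValue_succ hneg n),
      integral_prod_mul (fun p => Real.exp (-θ * cycle J 0 p)), ih, ← cycleDiscount]
    ring

lemma integral_stageValue_add_two (n : ℕ) :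
    ∫ ω, ω.1 * stageValue J θ h (n + 2) ω ∂prob =
      (∫ q, q.1 * Real.exp (-θ * (cycle J q.1 q.2 - q.1)) ∂initialLaw) *
      (cycleDiscount J θ ^ n * ∫ q, landedValue J θ h 0 q ∂noise.prod noiseSeq) := by
  rw [← measurePreserving_splitEquiv.integral_comp splitEquiv.measurableEmbedding,
    ← (measurePreserving_consRight initialLaw).integral_comp (consRight _).measurableEmbedding,
    ← integral_landedValue hneg, ← integral_prod_mul]
  refine integral_congr_ae ?_
  filter_upwards [ae_stageValue_add_two hneg n] with q hq
  rw [hq, ← mul_assoc]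
  rfl

variable (hJ : Measurable (Function.uncurry J))
include hJ

lemma integrable_exp_cycle (hθ : 0 ≤ θ) :
    Integrable (fun p => Real.exp (-θ * cycle J 0 p)) noise := by
  refine Integrable.of_bound (C := 1) ?_ ?_
  · exact (((measurable_cycle hJ).comp (measurable_const.prodMk measurable_id)).const_mul
      _).exp.aestronglyMeasurable
  · filter_upwards [ae_noise_pos] with p hp
    rw [Real.norm_eq_abs, Real.abs_exp, Real.exp_le_one_iff]
    nlinarith [cycle_pos hneg 0 hp]

lemma cycleDiscount_lt_one (hθ : 0 < θ) : cycleDiscount J θ < 1 := by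
  have hi := integrable_exp_cycle hneg hJ hθ.le
  have hpos : 0 < ∫ p, (1 - Real.exp (-θ * cycle J 0 p)) ∂noise := by
    have hp : ∀ᵐ p ∂noise, 0 < 1 - Real.exp (-θ * cycle J 0 p) := by
      filter_upwards [ae_noise_pos] with p hp
      rw [sub_pos, Real.exp_lt_one_iff]
      nlinarith [mul_pos hθ (cycle_pos hneg 0 hp)]
    exact integral_pos_of_ae_pos (by fun_prop) hp
  rw [integral_sub (integrable_const _) hi] at hpos
  simp only [integral_const, probReal_univ, smul_eq_mul, mul_one] at hpos
  rw [cycleDiscount]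
  linarith

/-- The `ENNReal` form of the same recursion presupposes no finiteness, so it can be used to prove
integrability. -/
lemma lintegral_landedValue (hθ : 0 ≤ θ) (hh : Measurable (Function.uncurry h)) (n : ℕ) :
    ∫⁻ q, ENNReal.ofReal (landedValue J θ h n q) ∂noise.prod noiseSeq =
      ENNReal.ofReal (cycleDiscount J θ) ^ n *
        ∫⁻ q, ENNReal.ofReal (landedValue J θ h 0 q) ∂noise.prod noiseSeq := by
  induction n with
  | zero => simp
  | succ n ih =>
    have hm : Measurable fun p => ENNReal.ofReal (Real.exp (-θ * cycle J 0 p)) :=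
      (((measurable_cycle hJ).comp (measurable_const.prodMk measurable_id)).const_mul
        _).exp.ennreal_ofReal
    rw [← (measurePreserving_consRight noise).lintegral_comp_emb
        (consRight _).measurableEmbedding, pow_succ', mul_assoc, ← ih, cycleDiscount,
      ofReal_integral_eq_lintegral_ofReal (integrable_exp_cycle hneg hJ hθ)
        (Eventually.of_forall fun _ => (Real.exp_pos _).le),
      ← lintegral_prod_mul hm.aemeasurable
        (measurable_landedValue hJ hh n).ennreal_ofReal.aemeasurable]
    refine lintegral_congr_ae ?_
    filter_upwards [ae_landedValue_succ hneg n] with q hq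
    rw [hq, ENNReal.ofReal_mul (Real.exp_pos _).le]

lemma lintegral_stageValue_add_two_le (hθ : 0 ≤ θ) (hh : Measurable (Function.uncurry h))
    (n : ℕ) :
    ∫⁻ ω, ENNReal.ofReal (stageValue J θ h (n + 2) ω) ∂prob ≤
      ENNReal.ofReal (cycleDiscount J θ) ^ n *
        ∫⁻ q, ENNReal.ofReal (landedValue J θ h 0 q) ∂noise.prod noiseSeq := by
  rw [← measurePreserving_splitEquiv.lintegral_comp_emb splitEquiv.measurableEmbedding,
    ← (measurePreserving_consRight initialLaw).lintegral_comp_emb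
      (consRight _).measurableEmbedding,
    ← lintegral_landedValue hneg hJ hθ hh]
  calc _ ≤ ∫⁻ q : (ℝ × (ℝ × ℝ)) × ((ℝ × ℝ) × (ℕ → ℝ × ℝ)),
        1 * ENNReal.ofReal (landedValue J θ h n q.2) ∂initialLaw.prod (noise.prod noiseSeq) := by
        refine lintegral_mono_ae ?_
        filter_upwards [ae_stageValue_add_two hneg n,
          Measure.quasiMeasurePreserving_fst.ae ae_initialLaw_pos] with q hq hpos
        rw [hq, ENNReal.ofReal_mul (Real.exp_pos _).le]
        gcongr
        rw [ENNReal.ofReal_le_one, Real.exp_le_one_iff]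
        nlinarith [cycle_sub_nonneg hneg q.1.1 hpos]
    _ = _ := by
        rw [lintegral_prod_mul (f := fun _ => 1) (by fun_prop)
          (measurable_landedValue hJ hh n).ennreal_ofReal.aemeasurable]
        simp

/-- The discounted squares of the locations after the jumps have a finite expectation. -/
lemma lintegral_tsum_stageValue_sq_lt_top (hθ : 0 < θ)
    (h0 : Integrable (fun p => landing J 0 p ^ 2) noise)
    (h1 : Integrable (fun q : ℝ × (ℝ × ℝ) => landing J q.1 q.2 ^ 2) initialLaw) :
    ∫⁻ ω, ∑' n, ENNReal.ofReal (stageValue J θ (fun z _ => z ^ 2) n ω) ∂prob < ⊤ := by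
  have hh : Measurable (Function.uncurry fun (z : ℝ) (_ : ℝ × ℝ) => z ^ 2) :=
    measurable_fst.pow_const 2
  have hm := fun n => (measurable_stageValue (θ := θ) hJ hh n).ennreal_ofReal
  -- Stages `0` and `1` precede regeneration and are bounded directly; the rest are dominated by a
  -- geometric series.
  rw [lintegral_tsum fun n => (hm n).aemeasurable, tsum_eq_zero_add' ENNReal.summable,
    tsum_eq_zero_add' ENNReal.summable]
  refine ENNReal.add_lt_top.2 ⟨?_, ENNReal.add_lt_top.2 ⟨?_, ?_⟩⟩
  · simp only [stageValue, skeleton, mul_zero, Real.exp_zero, one_mul]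
    have hx : Integrable (fun x : ℝ => x ^ 2) (gaussianReal 0 1) :=
      (memLp_id_gaussianReal 2).integrable_sq
    exact (hx.comp_fst noiseSeq).lintegral_lt_top
  · rw [← measurePreserving_splitEquiv.lintegral_comp_emb splitEquiv.measurableEmbedding]
    refine lt_of_le_of_lt (lintegral_mono_ae ?_) (h1.comp_fst noiseSeq).lintegral_lt_top
    filter_upwards [Measure.quasiMeasurePreserving_fst.ae ae_initialLaw_pos] with q hq
    refine ENNReal.ofReal_le_ofReal ?_
    rw [splitEquiv_apply, stageValue_cons _ _ hq.1]
    simp only [stageValue, skeleton, mul_zero, Real.exp_zero, one_mul]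
    refine mul_le_of_le_one_left (sq_nonneg _) (Real.exp_le_one_iff.2 ?_)
    nlinarith [le_peak q.1.1 hq.1.le]
  · have hb : ∫⁻ q, ENNReal.ofReal (landedValue J θ (fun z _ => z ^ 2) 0 q)
        ∂noise.prod noiseSeq < ⊤ := by
      refine lt_of_le_of_lt (lintegral_mono_ae ?_) (h0.comp_fst noiseSeq).lintegral_lt_top
      refine Eventually.of_forall fun q => ENNReal.ofReal_le_ofReal ?_
      simp only [landedValue, stageValue, skeleton, mul_zero, Real.exp_zero, one_mul]
      refine mul_le_of_le_one_left (sq_nonneg _) (Real.exp_le_one_iff.2 ?_)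
      nlinarith [peak_nonneg 0 q.1.1]
    refine lt_of_le_of_lt
      (ENNReal.tsum_le_tsum fun n => lintegral_stageValue_add_two_le hneg hJ hθ.le hh n) ?_
    rw [ENNReal.tsum_mul_right, ENNReal.tsum_geometric]
    refine ENNReal.mul_lt_top ?_ hb
    rw [ENNReal.inv_lt_top, tsub_pos_iff_lt, ENNReal.ofReal_lt_one]
    exact cycleDiscount_lt_one hneg hJ hθ

end

section

/-! ### Second moments and the expansion over the stages -/

lemma lt_peak (x : ℝ) {e : ℝ} (he : 0 < e) : x < peak x e :=
  (le_max_left x 0).trans_lt (Real.lt_sqrt_of_sq_lt (by linarith))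

lemma ae_prob_first_pos : ∀ᵐ ω ∂prob, 0 < (ω.2 0).1 := by
  have h : ∀ᵐ ξ ∂noiseSeq, 0 < (ξ 0).1 :=
    (measurePreserving_eval_infinitePi (fun _ : ℕ => noise) 0).quasiMeasurePreserving.ae
      (ae_noise_pos.mono fun p hp => hp.1)
  exact Measure.quasiMeasurePreserving_snd.ae h

lemma memLp_fst : MemLp (fun ω : Ω => ω.1) 2 prob :=
  (memLp_id_gaussianReal 2).comp_fst noiseSeq

lemma integral_fst : ∫ ω : Ω, ω.1 ∂prob = 0 := by
  rw [prob_eq, integral_fun_fst (f := fun x : ℝ => x)]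
  simp

/-- The contribution of one stage, of length `T` and started at `z`, to the discounted integral of
the location. -/
def segment (ρ z T : ℝ) : ℝ := ∫ s in (0 : ℝ)..T, Real.exp (-ρ * s) * (z + s)

lemma continuous_segment : Continuous fun q : ℝ × ℝ × ℝ => segment q.1 q.2.1 q.2.2 := by
  unfold segment
  exact intervalIntegral.continuous_parametric_intervalIntegral_of_continuous
    (f := fun (q : ℝ × ℝ × ℝ) s => Real.exp (-q.1 * s) * (q.2.1 + s)) (by fun_prop) (by fun_prop)

/-- The contribution of the stage started at `z`, as a function of the next clock. -/
def stageSegment (ρ z : ℝ) (p : ℝ × ℝ) : ℝ := segment ρ z (waitingTime z p.1)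

lemma measurable_stageSegment (ρ : ℝ) : Measurable (Function.uncurry (stageSegment ρ)) :=
  continuous_segment.measurable.comp (measurable_const.prodMk (measurable_fst.prodMk
    (measurable_waitingTime.comp (measurable_fst.prodMk measurable_snd.fst))))

variable {J : ℝ → ℝ → ℝ} {θ ρ : ℝ}

lemma process_zero_ae : process J 0 =ᵐ[prob] fun ω => ω.1 := by
  filter_upwards [ae_prob_first_pos] with ω hω
  have h : ((0 : ℝ), ω) ∈ stage J 0 := by
    refine ⟨le_rfl, ?_⟩
    simp only [skeleton, zero_add]
    rw [waitingTime_of_pos _ hω]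
    linarith [lt_peak ω.1 hω]
  rw [process_of_mem_stage h]
  simp [skeleton]

/-- On a stage, `(Z + (t - S))² ≤ 2 Z² + 2 t²`; since `S ≤ t`, inserting the discount `exp (-θ S)`
costs at most `exp (θ t)`. -/
lemma ofReal_process_sq_le (hθ : 0 ≤ θ) {t : ℝ} (ht : 0 ≤ t) (ω : Ω) :
    ENNReal.ofReal (process J t ω ^ 2) ≤ ENNReal.ofReal (2 * t ^ 2) +
      ENNReal.ofReal (2 * Real.exp (θ * t)) *
        ∑' n, ENNReal.ofReal (stageValue J θ (fun z _ => z ^ 2) n ω) := by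
  by_cases hω : ∃ n, (t, ω) ∈ stage J n
  · obtain ⟨n, hn⟩ := hω
    rw [process_of_mem_stage hn]
    set S := (skeleton J ω.1 ω.2 n).1 with hS
    set Z := (skeleton J ω.1 ω.2 n).2 with hZ
    have hS0 : 0 ≤ S := skeleton_fst_nonneg _ _ _
    have hSt : S ≤ t := hn.1
    have hexp : 1 ≤ Real.exp (θ * t) * Real.exp (-θ * S) := by
      rw [← Real.exp_add, Real.one_le_exp_iff]
      nlinarith
    calc ENNReal.ofReal ((Z + (t - S)) ^ 2)
        ≤ ENNReal.ofReal (2 * t ^ 2 + 2 * Real.exp (θ * t) * (Real.exp (-θ * S) * Z ^ 2)) := by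
          refine ENNReal.ofReal_le_ofReal ?_
          nlinarith [sq_nonneg (Z - (t - S)), mul_le_mul_of_nonneg_right hexp (sq_nonneg Z)]
      _ = ENNReal.ofReal (2 * t ^ 2) + ENNReal.ofReal (2 * Real.exp (θ * t)) *
            ENNReal.ofReal (stageValue J θ (fun z _ => z ^ 2) n ω) := by
          rw [ENNReal.ofReal_add (by positivity) (by positivity),
            ENNReal.ofReal_mul (p := 2 * Real.exp (θ * t)) (by positivity)]
          rfl
      _ ≤ _ := by
          gcongr
          exact ENNReal.le_tsum n
  · push Not at hω
    simp [process_of_notMem_stage hω]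

lemma measurable_process_right (hJ : Measurable (Function.uncurry J)) (t : ℝ) :
    Measurable (process J t) :=
  (measurable_process hJ).comp (measurable_const.prodMk measurable_id)

lemma setIntegral_stage (ω : Ω) (n : ℕ) :
    ∫ t in Set.Ioi (0 : ℝ), (stage J n).indicator
      (fun p : ℝ × Ω => Real.exp (-ρ * p.1) * (process J p.1 p.2 * p.2.1)) (t, ω) =
    ω.1 * stageValue J ρ (stageSegment ρ) n ω := by
  set S := (skeleton J ω.1 ω.2 n).1 with hS
  set Z := (skeleton J ω.1 ω.2 n).2 with hZ
  set T := waitingTime Z (ω.2 n).1 with hT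
  have hT0 : 0 ≤ T := waitingTime_nonneg _ _
  have hS0 : 0 ≤ S := skeleton_fst_nonneg _ _ _
  set g : ℝ → ℝ := fun t => ω.1 * (Real.exp (-ρ * S) * (Real.exp (-ρ * (t - S)) * (Z + (t - S))))
  have h1 : ∀ t, (stage J n).indicator
      (fun p : ℝ × Ω => Real.exp (-ρ * p.1) * (process J p.1 p.2 * p.2.1)) (t, ω) =
      (Set.Ico S (S + T)).indicator g t := by
    intro t
    by_cases ht : (t, ω) ∈ stage J n
    · rw [Set.indicator_of_mem ht, Set.indicator_of_mem (show t ∈ Set.Ico S (S + T) from ht),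
        process_of_mem_stage ht]
      have : Real.exp (-ρ * t) = Real.exp (-ρ * S) * Real.exp (-ρ * (t - S)) := by
        rw [← Real.exp_add]
        ring_nf
      simp only [g, this]
      ring
    · rw [Set.indicator_of_notMem ht,
        Set.indicator_of_notMem (show t ∉ Set.Ico S (S + T) from ht)]
  calc _ = ∫ t in Set.Ioi (0 : ℝ), (Set.Ioc S (S + T)).indicator g t := by
        simp_rw [h1]
        exact integral_congr_ae (ae_restrict_of_ae (indicator_ae_eq_of_ae_eq_set Ico_ae_eq_Ioc))
    _ = ∫ t in Set.Ioc S (S + T), g t := by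
        rw [setIntegral_indicator measurableSet_Ioc, Set.inter_eq_right.2]
        exact fun t ht => hS0.trans_lt ht.1
    _ = ∫ t in S..(S + T), g t := by
        rw [intervalIntegral.integral_of_le (by linarith)]
    _ = _ := by
        simp only [g]
        rw [intervalIntegral.integral_const_mul, intervalIntegral.integral_const_mul,
          intervalIntegral.integral_comp_sub_right
            (fun s => Real.exp (-ρ * s) * (Z + s)) S, sub_self, add_sub_cancel_left]
        rfl

variable (hJ : Measurable (Function.uncurry J))
include hJ

variable (hneg : ∀ y m : ℝ, 0 < y → 0 < m → J y m ≤ 0)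
  (h0 : Integrable (fun p => landing J 0 p ^ 2) noise)
  (h1 : Integrable (fun q : ℝ × (ℝ × ℝ) => landing J q.1 q.2 ^ 2) initialLaw)
include hneg h0 h1

lemma exists_integral_process_sq_le (hθ : 0 < θ) :
    ∃ C : ℝ, ∀ t : ℝ, 0 ≤ t → MemLp (process J t) 2 prob ∧
      ∫ ω, process J t ω ^ 2 ∂prob ≤ C * Real.exp (θ * t) := by
  set M := ∫⁻ ω, ∑' n, ENNReal.ofReal (stageValue J θ (fun z _ => z ^ 2) n ω) ∂prob with hM
  have hMtop : M < ⊤ := lintegral_tsum_stageValue_sq_lt_top hneg hJ hθ h0 h1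
  -- The first term absorbs `2 t²`, by `exp u ≥ 1 + u + u² / 2` at `u = θ t`.
  refine ⟨4 / θ ^ 2 + 2 * M.toReal, fun t ht => ?_⟩
  have hle : ∫⁻ ω, ENNReal.ofReal (process J t ω ^ 2) ∂prob ≤
      ENNReal.ofReal (2 * t ^ 2) + ENNReal.ofReal (2 * Real.exp (θ * t)) * M := by
    refine (lintegral_mono fun ω => ofReal_process_sq_le hθ.le ht ω).trans ?_
    rw [lintegral_add_left measurable_const, lintegral_const_mul' _ _ ENNReal.ofReal_ne_top]
    simp [hM]
  have hmeas := (measurable_process_right hJ t)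
  have hfin : ENNReal.ofReal (2 * t ^ 2) + ENNReal.ofReal (2 * Real.exp (θ * t)) * M < ⊤ :=
    ENNReal.add_lt_top.2 ⟨ENNReal.ofReal_lt_top, ENNReal.mul_lt_top ENNReal.ofReal_lt_top hMtop⟩
  have hint : Integrable (fun ω => process J t ω ^ 2) prob := by
    refine ⟨(hmeas.pow_const 2).aestronglyMeasurable, ?_⟩
    rw [hasFiniteIntegral_iff_ofReal (Eventually.of_forall fun ω => sq_nonneg _)]
    exact hle.trans_lt hfin
  refine ⟨(memLp_two_iff_integrable_sq hmeas.aestronglyMeasurable).2 hint, ?_⟩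
  rw [integral_eq_lintegral_of_nonneg_ae (Eventually.of_forall fun ω => sq_nonneg _)
    hint.aestronglyMeasurable]
  refine (ENNReal.toReal_mono hfin.ne hle).trans ?_
  rw [ENNReal.toReal_add ENNReal.ofReal_ne_top
    (ENNReal.mul_lt_top ENNReal.ofReal_lt_top hMtop).ne, ENNReal.toReal_mul,
    ENNReal.toReal_ofReal (by positivity), ENNReal.toReal_ofReal (by positivity)]
  have hq := Real.quadratic_le_exp_of_nonneg (x := θ * t) (by positivity)
  have : 2 * t ^ 2 ≤ 4 / θ ^ 2 * Real.exp (θ * t) := by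
    rw [div_mul_eq_mul_div, le_div_iff₀ (by positivity)]
    nlinarith [mul_nonneg hθ.le ht]
  linarith

lemma memLp_process {t : ℝ} (ht : 0 ≤ t) : MemLp (process J t) 2 prob :=
  (exists_integral_process_sq_le hJ hneg h0 h1 one_pos).choose_spec t ht |>.1

lemma covFun_process {t : ℝ} (ht : 0 ≤ t) :
    covFun (process J) t 0 = ∫ ω, process J t ω * ω.1 ∂prob := by
  have hR := memLp_process hJ hneg h0 h1 ht
  rw [covFun, covariance_eq_sub hR (memLp_process hJ hneg h0 h1 le_rfl),
    integral_congr_ae process_zero_ae, integral_fst, mul_zero, sub_zero]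
  refine integral_congr_ae ?_
  filter_upwards [process_zero_ae] with ω hω
  rw [Pi.mul_apply, hω]

lemma integrable_discounted_process (hρ : 0 < ρ) :
    Integrable (fun p : ℝ × Ω => Real.exp (-ρ * p.1) * (process J p.1 p.2 * p.2.1))
      ((volume.restrict (Set.Ioi 0)).prod prob) := by
  -- Growth at rate `ρ / 2` leaves the integrable factor `exp (-ρ t / 2)` after discounting.
  obtain ⟨C, hC⟩ := exists_integral_process_sq_le hJ hneg h0 h1 (half_pos hρ)
  have hx : Integrable (fun ω : Ω => ω.1 ^ 2) prob := memLp_fst.integrable_sq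
  have hm : Measurable fun p : ℝ × Ω => Real.exp (-ρ * p.1) * (process J p.1 p.2 * p.2.1) :=
    (measurable_fst.const_mul _).exp.mul ((measurable_process hJ).mul measurable_snd.fst)
  rw [integrable_prod_iff hm.aestronglyMeasurable]
  constructor
  · filter_upwards [ae_restrict_mem measurableSet_Ioi] with t ht
    exact ((hC t (le_of_lt ht)).1.integrable_mul memLp_fst).const_mul _
  · set X := ∫ ω : Ω, ω.1 ^ 2 ∂prob with hX
    have hdom : IntegrableOn (fun t => C * Real.exp (-(ρ / 2) * t) + X * Real.exp (-ρ * t))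
        (Set.Ioi 0) :=
      ((exp_neg_integrableOn_Ioi 0 (half_pos hρ)).const_mul C).add
        ((exp_neg_integrableOn_Ioi 0 hρ).const_mul X)
    refine Integrable.mono' hdom hm.norm.aestronglyMeasurable.integral_prod_right' ?_
    filter_upwards [ae_restrict_mem measurableSet_Ioi] with t ht
    have ht0 : (0 : ℝ) ≤ t := le_of_lt ht
    obtain ⟨hL, hb⟩ := hC t ht0
    rw [Real.norm_of_nonneg (integral_nonneg fun _ => norm_nonneg _)]
    have hle : ∫ ω, ‖Real.exp (-ρ * t) * (process J t ω * ω.1)‖ ∂prob ≤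
        ∫ ω, Real.exp (-ρ * t) * (process J t ω ^ 2 + ω.1 ^ 2) ∂prob := by
      refine integral_mono ((hL.integrable_mul memLp_fst).const_mul _).norm
        ((hL.integrable_sq.add hx).const_mul _) fun ω => ?_
      simp only [norm_mul, Real.norm_eq_abs, Real.abs_exp]
      gcongr
      nlinarith [sq_abs (process J t ω), sq_abs ω.1, sq_nonneg (|process J t ω| - |ω.1|),
        abs_nonneg (process J t ω), abs_nonneg ω.1,
        mul_nonneg (abs_nonneg (process J t ω)) (abs_nonneg ω.1)]
    refine hle.trans ?_
    rw [integral_const_mul, integral_add hL.integrable_sq hx]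
    have he : Real.exp (-ρ * t) * Real.exp (ρ / 2 * t) = Real.exp (-(ρ / 2) * t) := by
      rw [← Real.exp_add]
      ring_nf
    calc Real.exp (-ρ * t) * (∫ ω, process J t ω ^ 2 ∂prob + X)
        ≤ Real.exp (-ρ * t) * (C * Real.exp (ρ / 2 * t) + X) := by gcongr
      _ = C * Real.exp (-(ρ / 2) * t) + X * Real.exp (-ρ * t) := by
          rw [← he]
          ring
      _ ≤ _ := le_rfl

lemma integrableOn_discounted_covFun (hρ : 0 < ρ) :
    IntegrableOn (fun t => Real.exp (-ρ * t) * covFun (process J) t 0) (Set.Ioi 0) := by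
  refine (integrable_discounted_process hJ hneg h0 h1 hρ).integral_prod_left.congr ?_
  filter_upwards [ae_restrict_mem measurableSet_Ioi] with t ht
  rw [integral_const_mul, covFun_process hJ hneg h0 h1 (le_of_lt ht)]

/-- Fubini and countable additivity over the disjoint stages; the integrand vanishes off their
union. -/
lemma hasSum_stageValue (hρ : 0 < ρ) :
    HasSum (fun n => ∫ ω, ω.1 * stageValue J ρ (stageSegment ρ) n ω ∂prob)
      (∫ t in Set.Ioi (0 : ℝ), Real.exp (-ρ * t) * covFun (process J) t 0) := by
  have hF := integrable_discounted_process hJ hneg h0 h1 hρ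
  have hsum := hasSum_integral_iUnion (measurableSet_stage hJ) pairwise_disjoint_stage
    hF.integrableOn
  have hl : ∀ n, ∫ p in stage J n, Real.exp (-ρ * p.1) * (process J p.1 p.2 * p.2.1)
      ∂(volume.restrict (Set.Ioi 0)).prod prob =
      ∫ ω, ω.1 * stageValue J ρ (stageSegment ρ) n ω ∂prob := by
    intro n
    rw [← integral_indicator (measurableSet_stage hJ n),
      integral_prod_symm _ (hF.indicator (measurableSet_stage hJ n))]
    exact integral_congr_ae (Eventually.of_forall fun ω => setIntegral_stage ω n)
  have hr : ∫ p in ⋃ n, stage J n, Real.exp (-ρ * p.1) * (process J p.1 p.2 * p.2.1)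
      ∂(volume.restrict (Set.Ioi 0)).prod prob =
      ∫ t in Set.Ioi (0 : ℝ), Real.exp (-ρ * t) * covFun (process J) t 0 := by
    rw [setIntegral_eq_integral_of_forall_compl_eq_zero, integral_prod _ hF]
    · refine integral_congr_ae ?_
      filter_upwards [ae_restrict_mem measurableSet_Ioi] with t ht
      rw [integral_const_mul, covFun_process hJ hneg h0 h1 (le_of_lt ht)]
    · intro p hp
      rw [process_of_notMem_stage (t := p.1) (ω := p.2)
        fun n hn => hp (Set.mem_iUnion.2 ⟨n, hn⟩), zero_mul, mul_zero]
  rw [hr] at hsum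
  simpa only [hl] using hsum

/-- The Green-Kubo integral in terms of the first two stages and a geometric series. -/
lemma diffusivity_process (hρ : 0 < ρ) :
    diffusivity (process J) ρ =
      8 * (∫ ω, ω.1 * stageValue J ρ (stageSegment ρ) 0 ω ∂prob +
        (∫ ω, ω.1 * stageValue J ρ (stageSegment ρ) 1 ω ∂prob +
        (∫ q, q.1 * Real.exp (-ρ * (cycle J q.1 q.2 - q.1)) ∂initialLaw) *
          ((1 - cycleDiscount J ρ)⁻¹ *
            ∫ q, landedValue J ρ (stageSegment ρ) 0 q ∂noise.prod noiseSeq))) := by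
  have hs := hasSum_stageValue hJ hneg h0 h1 hρ
  have hg := ((hasSum_geometric_of_lt_one cycleDiscount_nonneg
    (cycleDiscount_lt_one hneg hJ hρ)).mul_right (∫ q, landedValue J ρ (stageSegment ρ) 0 q
      ∂noise.prod noiseSeq)).mul_left
      (∫ q, q.1 * Real.exp (-ρ * (cycle J q.1 q.2 - q.1)) ∂initialLaw)
  simp only [← integral_stageValue_add_two hneg] at hg
  rw [diffusivity, ← hs.tsum_eq, hs.summable.tsum_eq_zero_add,
    ((summable_nat_add_iff 1).2 hs.summable).tsum_eq_zero_add]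
  simp only [zero_add, add_assoc, Nat.reduceAdd]
  rw [hg.tsum_eq]

end

section

/-! ### The limit of small discount rates -/

lemma max_zero_sq_le (x : ℝ) : max x 0 ^ 2 ≤ x ^ 2 := by
  rcases max_cases x 0 with ⟨h, _⟩ | ⟨h, _⟩ <;> rw [h]
  nlinarith [sq_nonneg x]

/-- A quadratic bound uniform in `ρ`, for dominated convergence. -/
lemma abs_segment_le {ρ z y : ℝ} (hρ : 0 ≤ ρ) (hzy : z ≤ y) :
    |segment ρ z (y - z)| ≤ 3 * y ^ 2 + 4 * z ^ 2 := by
  have h := intervalIntegral.norm_integral_le_of_norm_le_const (a := 0) (b := y - z)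
    (C := |z| + (y - z)) (f := fun s => Real.exp (-ρ * s) * (z + s)) fun s hs => by
      rw [Set.uIoc_of_le (by linarith)] at hs
      rw [norm_mul, Real.norm_eq_abs, Real.abs_exp]
      have h1 : Real.exp (-ρ * s) ≤ 1 := by
        rw [Real.exp_le_one_iff]
        nlinarith [hs.1]
      have h2 : |z + s| ≤ |z| + (y - z) :=
        (abs_add_le z s).trans (by rw [abs_of_pos hs.1]; linarith [hs.2])
      calc _ ≤ 1 * (|z| + (y - z)) := by
            gcongr
            exact h2
        _ = _ := one_mul _
  rw [sub_zero, abs_of_nonneg (sub_nonneg.2 hzy), Real.norm_eq_abs] at h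
  refine h.trans ?_
  nlinarith [sq_abs z, sq_nonneg (|z| - (y - z)), sq_nonneg (y + z)]

lemma segment_zero (z y : ℝ) : segment 0 z (y - z) = (y ^ 2 - z ^ 2) / 2 := by
  simp only [segment, neg_zero, zero_mul, Real.exp_zero, one_mul]
  rw [intervalIntegral.integral_comp_add_left (fun u => u), integral_id]
  ring

lemma abs_stageSegment_le {ρ : ℝ} (hρ : 0 ≤ ρ) (z : ℝ) {p : ℝ × ℝ} (hp : 0 < p.1) :
    |stageSegment ρ z p| ≤ 7 * z ^ 2 + 6 * p.1 := by
  rw [stageSegment, waitingTime_of_pos z hp]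
  refine (abs_segment_le hρ (le_peak z hp.le)).trans ?_
  rw [sq_peak z hp.le]
  linarith [max_zero_sq_le z]

lemma tendsto_stageSegment (z : ℝ) {p : ℝ × ℝ} (hp : 0 < p.1) :
    Tendsto (fun ρ => stageSegment ρ z p) (𝓝[>] 0) (𝓝 ((max z 0 ^ 2 - z ^ 2) / 2 + p.1)) := by
  have hc : Continuous fun ρ => segment ρ z (peak z p.1 - z) :=
    continuous_segment.comp (by fun_prop : Continuous fun ρ : ℝ => (ρ, z, peak z p.1 - z))
  have ht := (hc.tendsto 0).mono_left (nhdsWithin_le_nhds (s := Set.Ioi 0))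
  rw [segment_zero, sq_peak z hp.le] at ht
  simp only [stageSegment, waitingTime_of_pos z hp]
  convert! ht using 2
  ring

/-- The first coordinate of the sequence is independent of everything else. -/
lemma integral_prod_noiseSeq {α : Type*} [MeasurableSpace α] (μ : Measure α) [SFinite μ]
    (f : α × (ℝ × ℝ) → ℝ) :
    ∫ q, f (q.1, q.2 0) ∂μ.prod noiseSeq = ∫ q, f q ∂μ.prod noise := by
  rw [← (measurePreserving_consRight μ).integral_comp (consRight α).measurableEmbedding,
    ← (measurePreserving_prodAssoc μ noise noiseSeq).integral_comp
      MeasurableEquiv.prodAssoc.measurableEmbedding]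
  have := integral_fun_fst (μ := μ.prod noise) (ν := noiseSeq) f
  rw [probReal_univ, one_smul] at this
  exact this

lemma tendsto_exp_neg_mul (c x : ℝ) :
    Tendsto (fun ρ => c * Real.exp (-ρ * x)) (𝓝[>] 0) (𝓝 c) := by
  have hc : Continuous fun ρ : ℝ => c * Real.exp (-ρ * x) := by fun_prop
  simpa using (hc.tendsto 0).mono_left (nhdsWithin_le_nhds (s := Set.Ioi 0))

section

variable (hI : Integrable (fun p : ℝ × ℝ => p.1) noise) (hE : ∫ p, p.1 ∂noise = 1)
include hI hE

/-- The expected discounted contribution of a stage with a random start, as the discount rate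
tends to zero. -/
lemma tendsto_integral_stageSegment {α : Type*} [MeasurableSpace α] {μ : Measure α}
    [IsFiniteMeasure μ] {g : ℝ → α → ℝ} {g₀ G z : α → ℝ} (hz : Measurable z)
    (hg : ∀ ρ, Measurable (g ρ)) (hlim : ∀ a, Tendsto (fun ρ => g ρ a) (𝓝[>] 0) (𝓝 (g₀ a)))
    (hG : ∀ ρ, 0 < ρ → ∀ᵐ a ∂μ, |g ρ a| ≤ G a) (hGi : Integrable G μ)
    (hGz : Integrable (fun a => G a * z a ^ 2) μ) :
    Tendsto (fun ρ => ∫ q, g ρ q.1 * stageSegment ρ (z q.1) q.2 ∂μ.prod noise) (𝓝[>] 0)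
      (𝓝 (∫ a, g₀ a * ((max (z a) 0 ^ 2 - z a ^ 2) / 2 + 1) ∂μ)) := by
  have hpos : ∀ᵐ q ∂μ.prod noise, 0 < q.2.1 :=
    Measure.quasiMeasurePreserving_snd.ae (ae_noise_pos.mono fun p hp => hp.1)
  have hbound : Integrable (fun q : α × (ℝ × ℝ) => 7 * (G q.1 * z q.1 ^ 2) +
      6 * (G q.1 * q.2.1)) (μ.prod noise) :=
    ((hGz.comp_fst noise).const_mul 7).add ((hGi.mul_prod hI).const_mul 6)
  have hmain : Tendsto (fun ρ => ∫ q, g ρ q.1 * stageSegment ρ (z q.1) q.2 ∂μ.prod noise)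
      (𝓝[>] 0) (𝓝 (∫ q, g₀ q.1 * ((max (z q.1) 0 ^ 2 - z q.1 ^ 2) / 2 + q.2.1)
        ∂μ.prod noise)) := by
    refine tendsto_integral_filter_of_dominated_convergence
      (fun q => 7 * (G q.1 * z q.1 ^ 2) + 6 * (G q.1 * q.2.1)) ?_ ?_ hbound ?_
    · refine Eventually.of_forall fun ρ => Measurable.aestronglyMeasurable ?_
      have hs : Measurable fun q : α × (ℝ × ℝ) =>
          Function.uncurry (stageSegment ρ) (z q.1, q.2) :=
        (measurable_stageSegment ρ).comp (by fun_prop)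
      exact Measurable.mul (f := fun q : α × (ℝ × ℝ) => g ρ q.1) (by fun_prop) hs
    · filter_upwards [self_mem_nhdsWithin] with ρ hρ
      filter_upwards [hpos, Measure.quasiMeasurePreserving_fst.ae (hG ρ hρ)] with q hq hGq
      rw [norm_mul, Real.norm_eq_abs, Real.norm_eq_abs]
      calc |g ρ q.1| * |stageSegment ρ (z q.1) q.2| ≤ G q.1 * (7 * z q.1 ^ 2 + 6 * q.2.1) :=
            mul_le_mul hGq (abs_stageSegment_le (le_of_lt hρ) _ hq) (abs_nonneg _)
              ((abs_nonneg _).trans hGq)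
        _ = _ := by ring
    · filter_upwards [hpos] with q hq
      exact (hlim q.1).mul (tendsto_stageSegment _ hq)
  have hg₀m : AEStronglyMeasurable g₀ μ :=
    aestronglyMeasurable_of_tendsto_ae (𝓝[>] (0 : ℝ)) (fun ρ => (hg ρ).aestronglyMeasurable)
      (Eventually.of_forall hlim)
  -- The exceptional null set depends on `ρ`, so the bound passes to the limit along the countable
  -- sequence `1 / (n + 1)`.
  have hg₀ : ∀ᵐ a ∂μ, |g₀ a| ≤ G a := by
    have hu : ∀ᵐ a ∂μ, ∀ n : ℕ, |g (1 / ((n : ℝ) + 1)) a| ≤ G a :=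
      ae_all_iff.2 fun n => hG _ (by positivity)
    filter_upwards [hu] with a ha
    have hseq : Tendsto (fun n : ℕ => 1 / ((n : ℝ) + 1)) atTop (𝓝[>] 0) :=
      tendsto_nhdsWithin_iff.2 ⟨tendsto_one_div_add_atTop_nhds_zero_nat,
        Eventually.of_forall fun n => Set.mem_Ioi.2 (by positivity)⟩
    exact le_of_tendsto' ((hlim a).comp hseq).abs ha
  have hi1 : Integrable g₀ μ := hGi.mono' hg₀m hg₀
  have hi2 : Integrable (fun a => g₀ a * ((max (z a) 0 ^ 2 - z a ^ 2) / 2)) μ := by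
    refine hGz.mono' (hg₀m.mul (by fun_prop)) ?_
    filter_upwards [hg₀] with a ha
    rw [norm_mul, Real.norm_eq_abs, Real.norm_eq_abs]
    refine mul_le_mul ha ?_ (abs_nonneg _) ((abs_nonneg _).trans ha)
    rw [abs_le]
    constructor <;> linarith [max_zero_sq_le (z a), sq_nonneg (max (z a) 0)]
  -- The clock is independent of the start, so it may be replaced by its mean `1`.
  convert! hmain using 2
  simp only [mul_add, mul_one]
  rw [integral_add hi2 hi1, integral_add (hi2.comp_fst noise) (hi1.mul_prod hI),
    integral_prod_mul g₀ (fun p : ℝ × ℝ => p.1), hE, mul_one,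
    integral_fun_fst (f := fun a => g₀ a * ((max (z a) 0 ^ 2 - z a ^ 2) / 2)), probReal_univ,
    one_smul]

variable {J : ℝ → ℝ → ℝ} (hJ : Measurable (Function.uncurry J))
  (hneg : ∀ y m : ℝ, 0 < y → 0 < m → J y m ≤ 0)

lemma tendsto_stage_zero :
    Tendsto (fun ρ => ∫ ω, ω.1 * stageValue J ρ (stageSegment ρ) 0 ω ∂prob) (𝓝[>] 0)
      (𝓝 (∫ x, x * ((max x 0 ^ 2 - x ^ 2) / 2 + 1) ∂gaussianReal 0 1)) := by
  have hp3 : Integrable (fun x : ℝ => |x| ^ 3) (gaussianReal 0 1) := by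
    have := (memLp_id_gaussianReal (μ := 0) (v := 1) 3).integrable_norm_pow (p := 3) (by norm_num)
    simpa using this
  have h := tendsto_integral_stageSegment hI hE (μ := gaussianReal 0 1) (g := fun _ x => x)
    (g₀ := fun x => x) (G := fun x => |x|) (z := fun x => x) measurable_id
    (fun _ => measurable_id) (fun _ => tendsto_const_nhds)
    (fun _ _ => Eventually.of_forall fun _ => le_rfl)
    ((memLp_id_gaussianReal 1).integrable le_rfl).abs
    (hp3.congr (Eventually.of_forall fun x => by
      simp only
      rw [← sq_abs x]
      ring))
  refine h.congr fun ρ => ?_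
  rw [← integral_prod_noiseSeq]
  simp [stageValue, skeleton, prob_eq]

include hJ hneg

lemma tendsto_stage_one
    (h1 : Integrable (fun q : ℝ × (ℝ × ℝ) => |q.1| * landing J q.1 q.2 ^ 2) initialLaw) :
    Tendsto (fun ρ => ∫ ω, ω.1 * stageValue J ρ (stageSegment ρ) 1 ω ∂prob) (𝓝[>] 0)
      (𝓝 (∫ q, q.1 * (1 - landing J q.1 q.2 ^ 2 / 2) ∂initialLaw)) := by
  have hm : Measurable fun q : ℝ × (ℝ × ℝ) => peak q.1 q.2.1 :=
    measurable_peak.comp (measurable_fst.prodMk measurable_snd.fst)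
  have h := tendsto_integral_stageSegment hI hE (μ := initialLaw)
    (g := fun ρ q => q.1 * Real.exp (-ρ * (peak q.1 q.2.1 - q.1)))
    (g₀ := fun q => q.1) (G := fun q => |q.1|) (z := fun q => landing J q.1 q.2)
    (measurable_landing hJ)
    (fun ρ => measurable_fst.mul ((hm.sub measurable_fst).const_mul _).exp)
    (fun q => tendsto_exp_neg_mul _ _) ?_
    (((memLp_id_gaussianReal 1).integrable le_rfl).abs.comp_fst noise) h1
  · have hlim : ∫ q, q.1 * ((max (landing J q.1 q.2) 0 ^ 2 - landing J q.1 q.2 ^ 2) / 2 + 1)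
        ∂initialLaw = ∫ q, q.1 * (1 - landing J q.1 q.2 ^ 2 / 2) ∂initialLaw := by
      refine integral_congr_ae ?_
      filter_upwards [ae_initialLaw_pos] with q hq
      simp only [max_eq_right (landing_nonpos hneg q.1 hq)]
      ring
    rw [hlim] at h
    refine h.congr fun ρ => ?_
    rw [← integral_prod_noiseSeq,
      ← measurePreserving_splitEquiv.integral_comp splitEquiv.measurableEmbedding]
    refine integral_congr_ae ?_
    filter_upwards [Measure.quasiMeasurePreserving_fst.ae ae_initialLaw_pos] with q hq
    rw [splitEquiv_apply, stageValue_cons _ _ hq.1, mul_assoc]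
    simp [stageValue, skeleton]
  · intro ρ hρ
    filter_upwards [ae_initialLaw_pos] with q hq
    rw [abs_mul, Real.abs_exp]
    refine mul_le_of_le_one_right (abs_nonneg _) (Real.exp_le_one_iff.2 ?_)
    nlinarith [le_peak q.1 hq.1.le]

/-- The undiscounted mean of a regenerated stage is `1 - E[landing²] / 2`, which the second moment
`2` makes vanish. -/
lemma tendsto_landedValue (h0 : Integrable (fun p => landing J 0 p ^ 2) noise)
    (h2 : ∫ p, landing J 0 p ^ 2 ∂noise = 2) :
    Tendsto (fun ρ => ∫ q, landedValue J ρ (stageSegment ρ) 0 q ∂noise.prod noiseSeq) (𝓝[>] 0)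
      (𝓝 0) := by
  have hm : Measurable fun p : ℝ × ℝ => peak 0 p.1 :=
    measurable_peak.comp (measurable_const.prodMk measurable_fst)
  have h := tendsto_integral_stageSegment hI hE (μ := noise)
    (g := fun ρ p => 1 * Real.exp (-ρ * peak 0 p.1))
    (g₀ := fun _ => 1) (G := fun _ => 1) (z := landing J 0)
    ((measurable_landing hJ).comp (measurable_const.prodMk measurable_id))
    (fun ρ => ((hm.const_mul _).exp).const_mul 1)
    (fun q => tendsto_exp_neg_mul _ _) ?_ (integrable_const _) (by simpa using h0)
  · have hlim : ∫ p, 1 * ((max (landing J 0 p) 0 ^ 2 - landing J 0 p ^ 2) / 2 + 1)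
        ∂noise = 0 := by
      have : ∫ p, (1 - landing J 0 p ^ 2 / 2) ∂noise = 0 := by
        rw [integral_sub (integrable_const _) (h0.div_const 2), integral_div, h2]
        simp
      refine (integral_congr_ae ?_).trans this
      filter_upwards [ae_noise_pos] with p hp
      simp only [max_eq_right (landing_nonpos hneg 0 hp)]
      ring
    rw [hlim] at h
    refine h.congr fun ρ => ?_
    rw [← integral_prod_noiseSeq]
    simp only [landedValue, stageValue, skeleton, mul_zero, Real.exp_zero, one_mul]
  · intro ρ hρ
    refine Eventually.of_forall fun p => ?_
    rw [one_mul, Real.abs_exp, Real.exp_le_one_iff]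
    nlinarith [peak_nonneg 0 p.1]

/-! ### Linear rates for the geometric tail. -/

omit hE

lemma integrable_mul_cycle_sub
    (h1 : Integrable (fun q : ℝ × (ℝ × ℝ) => landing J q.1 q.2 ^ 2) initialLaw) :
    Integrable (fun q : ℝ × (ℝ × ℝ) => |q.1| * (cycle J q.1 q.2 - q.1)) initialLaw := by
  have hx : Integrable (fun q : ℝ × (ℝ × ℝ) => q.1 ^ 2) initialLaw :=
    (memLp_id_gaussianReal 2).integrable_sq.comp_fst noise
  have he : Integrable (fun q : ℝ × (ℝ × ℝ) => q.2.1) initialLaw :=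
    hI.comp_snd (gaussianReal 0 1)
  refine (((hx.const_mul 3).add he).add h1).mono'
    (measurable_fst.abs.mul ((measurable_cycle hJ).sub measurable_fst)).aestronglyMeasurable ?_
  filter_upwards [ae_initialLaw_pos] with q hq
  have hc := cycle_sub_nonneg hneg q.1 hq
  have hsq := sq_peak q.1 hq.1.le
  have hmax := max_zero_sq_le q.1
  rw [Real.norm_of_nonneg (mul_nonneg (abs_nonneg _) hc), cycle]
  simp only [Pi.add_apply]
  -- AM-GM on `|x| * peak` and `-|x| * landing`, together with `-x |x| ≤ x²` and `peak² ≤ x² + 2e`.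
  nlinarith [sq_abs q.1, sq_nonneg (|q.1| - peak q.1 q.2.1), sq_nonneg (|q.1| + landing J q.1 q.2),
    neg_abs_le q.1, mul_nonneg (abs_nonneg q.1) (add_nonneg (abs_nonneg q.1) (abs_nonneg q.1)),
    mul_nonneg (abs_nonneg q.1) (by linarith [neg_abs_le q.1] : 0 ≤ |q.1| + q.1)]

omit hI

/-- As `E[x] = 0`, the exponential may be replaced by `exp (-ρ c) - 1`, of size at most `ρ c`, where
`c ≥ 0` is the return time. -/
lemma abs_integral_mul_exp_le
    (hi : Integrable (fun q : ℝ × (ℝ × ℝ) => |q.1| * (cycle J q.1 q.2 - q.1)) initialLaw)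
    {ρ : ℝ} (hρ : 0 < ρ) :
    |∫ q, q.1 * Real.exp (-ρ * (cycle J q.1 q.2 - q.1)) ∂initialLaw| ≤
      ρ * ∫ q, |q.1| * (cycle J q.1 q.2 - q.1) ∂initialLaw := by
  have hx : Integrable (fun q : ℝ × (ℝ × ℝ) => q.1) initialLaw :=
    ((memLp_id_gaussianReal 1).integrable le_rfl).comp_fst noise
  have hx0 : ∫ q : ℝ × (ℝ × ℝ), q.1 ∂initialLaw = 0 := by
    rw [initialLaw, integral_fun_fst (f := fun x : ℝ => x)]
    simp
  have hm : Measurable fun q : ℝ × (ℝ × ℝ) =>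
      q.1 * Real.exp (-ρ * (cycle J q.1 q.2 - q.1)) :=
    measurable_fst.mul (((measurable_cycle hJ).sub measurable_fst).const_mul _).exp
  have hi' : Integrable (fun q : ℝ × (ℝ × ℝ) =>
      q.1 * Real.exp (-ρ * (cycle J q.1 q.2 - q.1))) initialLaw := by
    refine hx.abs.mono' hm.aestronglyMeasurable ?_
    filter_upwards [ae_initialLaw_pos] with q hq
    rw [norm_mul, Real.norm_eq_abs, Real.norm_eq_abs, Real.abs_exp]
    refine mul_le_of_le_one_right (abs_nonneg _) (Real.exp_le_one_iff.2 ?_)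
    nlinarith [cycle_sub_nonneg hneg q.1 hq]
  rw [← sub_zero (∫ q, _ ∂initialLaw), ← hx0, ← integral_sub hi' hx, ← integral_const_mul]
  refine (abs_integral_le_integral_abs).trans
    (integral_mono_ae (hi'.sub hx).abs (hi.const_mul ρ) ?_)
  filter_upwards [ae_initialLaw_pos] with q hq
  have hc := cycle_sub_nonneg hneg q.1 hq
  have h1 : Real.exp (-ρ * (cycle J q.1 q.2 - q.1)) ≤ 1 := by
    rw [Real.exp_le_one_iff]
    nlinarith
  have h2 := Real.add_one_le_exp (-ρ * (cycle J q.1 q.2 - q.1))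
  calc |q.1 * Real.exp (-ρ * (cycle J q.1 q.2 - q.1)) - q.1|
      = |q.1| * |Real.exp (-ρ * (cycle J q.1 q.2 - q.1)) - 1| := by
        rw [← abs_mul]
        ring_nf
    _ ≤ |q.1| * (ρ * (cycle J q.1 q.2 - q.1)) := by
        gcongr
        rw [abs_of_nonpos (by linarith)]
        linarith
    _ = _ := by ring

/-- The expected discount over a cycle decays at least linearly in the discount rate. -/
lemma exists_mul_le_one_sub_cycleDiscount :
    ∃ k : ℝ, 0 < k ∧ ∀ ρ : ℝ, 0 < ρ → ρ ≤ 1 → ρ * k ≤ 1 - cycleDiscount J ρ := by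
  have hm : Measurable (cycle J 0) :=
    (measurable_cycle hJ).comp (measurable_const.prodMk measurable_id)
  have hi : Integrable (fun p => cycle J 0 p * Real.exp (-cycle J 0 p)) noise := by
    refine Integrable.of_bound (C := 1) (hm.mul hm.neg.exp).aestronglyMeasurable ?_
    filter_upwards [ae_noise_pos] with p hp
    have hc := cycle_pos hneg 0 hp
    rw [Real.norm_of_nonneg (by positivity), Real.exp_neg, ← div_eq_mul_inv,
      div_le_one (Real.exp_pos _)]
    linarith [Real.add_one_le_exp (cycle J 0 p)]
  -- For `ρ ≤ 1`, `1 - exp (-ρ c) ≥ ρ c exp (-ρ c) ≥ ρ c exp (-c)`. The weight `exp (-c)` keeps the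
  -- integrand bounded.
  refine ⟨∫ p, cycle J 0 p * Real.exp (-cycle J 0 p) ∂noise,
    integral_pos_of_ae_pos hi ?_, fun ρ hρ hρ1 => ?_⟩
  · filter_upwards [ae_noise_pos] with p hp
    exact mul_pos (cycle_pos hneg 0 hp) (Real.exp_pos _)
  · have hone : (1 : ℝ) = ∫ _, (1 : ℝ) ∂noise := by simp
    have hie := integrable_exp_cycle hneg hJ hρ.le
    rw [cycleDiscount, hone, ← integral_sub (integrable_const _) hie, ← integral_const_mul]
    refine integral_mono_ae (hi.const_mul ρ) ((integrable_const _).sub hie) ?_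
    filter_upwards [ae_noise_pos] with p hp
    have hc := cycle_pos hneg 0 hp
    have h1 := Real.add_one_le_exp (ρ * cycle J 0 p)
    have h2 : Real.exp (ρ * cycle J 0 p) * Real.exp (-ρ * cycle J 0 p) = 1 := by
      rw [← Real.exp_add]
      simp
    have h3 : Real.exp (-cycle J 0 p) ≤ Real.exp (-ρ * cycle J 0 p) := by
      rw [Real.exp_le_exp]
      nlinarith
    have h4 : (ρ * cycle J 0 p + 1) * Real.exp (-ρ * cycle J 0 p) ≤ 1 :=
      (mul_le_mul_of_nonneg_right h1 (Real.exp_pos _).le).trans h2.le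
    have h5 := mul_le_mul_of_nonneg_left h3 (mul_nonneg hρ.le hc.le)
    linarith

include hI hE

/-- The Green-Kubo integral for a jump map that preserves the second moment. -/
theorem tendsto_diffusivity_process
    (h0 : Integrable (fun p => landing J 0 p ^ 2) noise)
    (h2 : ∫ p, landing J 0 p ^ 2 ∂noise = 2)
    (h1 : Integrable (fun q : ℝ × (ℝ × ℝ) => landing J q.1 q.2 ^ 2) initialLaw)
    (h3 : Integrable (fun q : ℝ × (ℝ × ℝ) => |q.1| * landing J q.1 q.2 ^ 2) initialLaw) :
    Tendsto (diffusivity (process J)) (𝓝[>] 0)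
      (𝓝 (8 * (∫ x, x * ((max x 0 ^ 2 - x ^ 2) / 2 + 1) ∂gaussianReal 0 1 +
        ∫ q, q.1 * (1 - landing J q.1 q.2 ^ 2 / 2) ∂initialLaw))) := by
  have hβ := tendsto_landedValue hI hE hJ hneg h0 h2
  obtain ⟨k, hk, hle⟩ := exists_mul_le_one_sub_cycleDiscount hJ hneg
  have hi := integrable_mul_cycle_sub hI hJ hneg h1
  set K := ∫ q, |q.1| * (cycle J q.1 q.2 - q.1) ∂initialLaw with hK
  have htail : Tendsto (fun ρ =>
      (∫ q, q.1 * Real.exp (-ρ * (cycle J q.1 q.2 - q.1)) ∂initialLaw) *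
        ((1 - cycleDiscount J ρ)⁻¹ *
          ∫ q, landedValue J ρ (stageSegment ρ) 0 q ∂noise.prod noiseSeq)) (𝓝[>] 0) (𝓝 0) := by
    have hb : Tendsto (fun ρ => K / k *
        |∫ q, landedValue J ρ (stageSegment ρ) 0 q ∂noise.prod noiseSeq|) (𝓝[>] 0) (𝓝 0) := by
      simpa using hβ.abs.const_mul (K / k)
    refine squeeze_zero_norm' ?_ hb
    filter_upwards [Ioc_mem_nhdsGT one_pos] with ρ hρ
    have hr : 0 < ρ * k := mul_pos hρ.1 hk
    have hr' := hle ρ hρ.1 hρ.2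
    rw [norm_mul, norm_mul, norm_inv, Real.norm_eq_abs, Real.norm_eq_abs, Real.norm_eq_abs,
      abs_of_pos (hr.trans_le hr')]
    -- The powers of `ρ` cancel, leaving a constant times the vanishing stage value.
    calc _ ≤ (ρ * K) * ((ρ * k)⁻¹ *
          |∫ q, landedValue J ρ (stageSegment ρ) 0 q ∂noise.prod noiseSeq|) := by
          have hρK := abs_integral_mul_exp_le hJ hneg hi hρ.1
          refine mul_le_mul hρK ?_
            (mul_nonneg (inv_nonneg.2 (hr.le.trans hr')) (abs_nonneg _)) ((abs_nonneg _).trans hρK)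
          gcongr
      _ = _ := by
          have := hρ.1.ne'
          field_simp
  have hsum := ((tendsto_stage_zero (J := J) hI hE).add
    ((tendsto_stage_one hI hE hJ hneg h3).add htail)).const_mul 8
  rw [add_zero] at hsum
  refine hsum.congr' ?_
  filter_upwards [self_mem_nhdsWithin] with ρ hρ
  exact (diffusivity_process hJ hneg h0 h1 hρ).symm

end

end

section

/-! ### Moments -/

lemma integrable_expMeasure_id : Integrable (fun e : ℝ => e) (expMeasure 1) ∧
    ∫ e, e ∂expMeasure 1 = 1 := by
  have hm : Measurable (gammaPDF 1 1) := (measurable_gammaPDFReal 1 1).ennreal_ofReal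
  have htop : ∀ᵐ x : ℝ, gammaPDF 1 1 x < ⊤ := Eventually.of_forall fun x => ENNReal.ofReal_lt_top
  have hG : IntegrableOn (fun x : ℝ => Real.exp (-x) * x) (Set.Ioi 0) := by
    have h := Real.GammaIntegral_convergent (s := 2) two_pos
    norm_num at h
    exact h
  have hGv : ∫ x in Set.Ioi (0 : ℝ), Real.exp (-x) * x = 1 := by
    have h := Real.Gamma_eq_integral (s := 2) two_pos
    rw [Real.Gamma_two] at h
    rw [h]
    norm_num
  have heq : (fun x : ℝ => (gammaPDF 1 1 x).toReal • x) =ᵐ[volume]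
      (Set.Ioi 0).indicator fun x => Real.exp (-x) * x := by
    refine Eventually.of_forall fun x => ?_
    by_cases hx : 0 < x
    · simp only [Set.indicator_of_mem (Set.mem_Ioi.2 hx), gammaPDF_of_nonneg hx.le]
      simp [ENNReal.toReal_ofReal (Real.exp_pos _).le]
    · rw [Set.indicator_of_notMem (by simpa using hx)]
      rcases eq_or_lt_of_le (not_lt.1 hx) with rfl | hx
      · simp
      · simp [gammaPDF_of_neg hx]
  constructor
  · change Integrable _ (volume.withDensity (gammaPDF 1 1))
    rw [integrable_withDensity_iff_integrable_smul' hm htop, integrable_congr heq,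
      integrable_indicator_iff measurableSet_Ioi]
    exact hG
  · change ∫ e, e ∂volume.withDensity (gammaPDF 1 1) = 1
    rw [integral_withDensity_eq_integral_toReal_smul hm htop, integral_congr_ae heq,
      integral_indicator measurableSet_Ioi, hGv]

lemma integrable_noise_fst : Integrable (fun p : ℝ × ℝ => p.1) noise :=
  integrable_expMeasure_id.1.comp_fst rayleigh

lemma integral_noise_fst : ∫ p : ℝ × ℝ, p.1 ∂noise = 1 := by
  have := isProbabilityMeasure_expMeasure one_pos
  rw [noise, integral_fun_fst (f := fun e : ℝ => e), integrable_expMeasure_id.2]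
  simp

/-- Serves both the Rayleigh second moment and the third moment of the Gaussian on the positive
half-line. -/
lemma integrableOn_cube_mul_exp :
    IntegrableOn (fun x : ℝ => x ^ 3 * Real.exp (-x ^ 2 / 2)) (Set.Ioi 0) ∧
    ∫ x in Set.Ioi (0 : ℝ), x ^ 3 * Real.exp (-x ^ 2 / 2) = 2 := by
  have h (x : ℝ) : x ^ (3 : ℝ) * Real.exp (-(1 / 2) * x ^ (2 : ℝ)) =
      x ^ 3 * Real.exp (-x ^ 2 / 2) := by
    rw [Real.rpow_two, show (3 : ℝ) = ((3 : ℕ) : ℝ) by norm_num, Real.rpow_natCast]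
    ring_nf
  constructor
  · have := integrableOn_rpow_mul_exp_neg_mul_rpow (p := 2) (s := 3) (b := 1 / 2)
      (by norm_num) (by norm_num) (by norm_num)
    simpa only [h] using this
  · have := integral_rpow_mul_exp_neg_mul_rpow (p := 2) (q := 3) (b := 1 / 2)
      (by norm_num) (by norm_num) (by norm_num)
    simp only [h] at this
    rw [this, show ((3 : ℝ) + 1) / 2 = 2 by norm_num, Real.Gamma_two,
      show -((3 : ℝ) + 1) / 2 = ((-2 : ℤ) : ℝ) by norm_num, Real.rpow_intCast]
    norm_num

lemma integrable_rayleigh_sq : Integrable (fun m : ℝ => m ^ 2) rayleigh ∧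
    ∫ m, m ^ 2 ∂rayleigh = 2 := by
  have hm : Measurable fun x : ℝ => ENNReal.ofReal (x * Real.exp (-x ^ 2 / 2)) := by fun_prop
  have htop : ∀ᵐ x : ℝ ∂volume.restrict (Set.Ioi 0),
      ENNReal.ofReal (x * Real.exp (-x ^ 2 / 2)) < ⊤ :=
    Eventually.of_forall fun x => ENNReal.ofReal_lt_top
  have heq : (fun x : ℝ => (ENNReal.ofReal (x * Real.exp (-x ^ 2 / 2))).toReal • x ^ 2)
      =ᵐ[volume.restrict (Set.Ioi 0)] fun x => x ^ 3 * Real.exp (-x ^ 2 / 2) := by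
    filter_upwards [ae_restrict_mem measurableSet_Ioi] with x hx
    rw [ENNReal.toReal_ofReal (mul_nonneg (le_of_lt hx) (Real.exp_pos _).le), smul_eq_mul]
    ring
  constructor
  · rw [rayleigh, integrable_withDensity_iff_integrable_smul' hm htop, integrable_congr heq]
    exact integrableOn_cube_mul_exp.1
  · rw [rayleigh, integral_withDensity_eq_integral_toReal_smul hm htop, integral_congr_ae heq,
      integrableOn_cube_mul_exp.2]

/-! ### Gaussian moments. -/

lemma integrable_gaussian_pow (n : ℕ) : Integrable (fun x : ℝ => x ^ n) (gaussianReal 0 1) := by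
  have h : MemLp id (n : ENNReal) (gaussianReal 0 1) := memLp_id_gaussianReal' _ (by simp)
  rcases eq_or_ne n 0 with rfl | hn
  · simp
  refine (integrable_norm_iff (by fun_prop)).1 ?_
  simpa using h.integrable_norm_pow hn

lemma integrable_gaussian_abs_mul_sq :
    Integrable (fun x : ℝ => |x| * x ^ 2) (gaussianReal 0 1) := by
  refine (integrable_gaussian_pow 3).abs.congr (Eventually.of_forall fun x => ?_)
  simp only
  rw [pow_succ', abs_mul, abs_of_nonneg (sq_nonneg x)]

lemma integrable_gaussian_mul_max_sq :
    Integrable (fun x : ℝ => x * max x 0 ^ 2) (gaussianReal 0 1) := by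
  refine integrable_gaussian_abs_mul_sq.mono' (by fun_prop) (Eventually.of_forall fun x => ?_)
  rw [norm_mul, Real.norm_eq_abs, Real.norm_of_nonneg (sq_nonneg _)]
  exact mul_le_mul_of_nonneg_left (max_zero_sq_le x) (abs_nonneg x)

lemma integral_gaussian_cube : ∫ x : ℝ, x ^ 3 ∂gaussianReal 0 1 = 0 := by
  have h := integral_map (μ := gaussianReal 0 1) (φ := fun x : ℝ => -x) (f := fun x : ℝ => x ^ 3)
    (by fun_prop) (by fun_prop)
  rw [gaussianReal_map_neg, neg_zero] at h
  have h3 : ∀ x : ℝ, (-x) ^ 3 = -x ^ 3 := fun x => by ring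
  simp only [h3, integral_neg] at h
  linarith

lemma integral_gaussian_mul_max_sq :
    ∫ x : ℝ, x * max x 0 ^ 2 ∂gaussianReal 0 1 = 2 * (Real.sqrt (2 * Real.pi))⁻¹ := by
  rw [integral_gaussianReal_eq_integral_smul one_ne_zero]
  have h : ∀ x : ℝ, gaussianPDFReal 0 1 x • (x * max x 0 ^ 2) =
      (Set.Ioi 0).indicator
        (fun x => (Real.sqrt (2 * Real.pi))⁻¹ * (x ^ 3 * Real.exp (-x ^ 2 / 2))) x := by
    intro x
    by_cases hx : 0 < x
    · rw [Set.indicator_of_mem (Set.mem_Ioi.2 hx), max_eq_left hx.le]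
      simp only [gaussianPDFReal, NNReal.coe_one, mul_one, sub_zero, smul_eq_mul]
      ring
    · rw [Set.indicator_of_notMem (by simpa using hx), max_eq_right (not_lt.1 hx)]
      simp
  simp only [h]
  rw [integral_indicator measurableSet_Ioi, integral_const_mul, integrableOn_cube_mul_exp.2]
  ring

/-- The odd moments of `x` and `x³` vanish; only `x x₊² / 2` survives. -/
lemma integral_gaussian_stage_zero :
    ∫ x, x * ((max x 0 ^ 2 - x ^ 2) / 2 + 1) ∂gaussianReal 0 1 =
      (Real.sqrt (2 * Real.pi))⁻¹ := by
  have h : ∀ x : ℝ, x * ((max x 0 ^ 2 - x ^ 2) / 2 + 1) =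
      (x * max x 0 ^ 2 - x ^ 3) / 2 + x := fun x => by ring
  have h1 : Integrable (fun x : ℝ => x) (gaussianReal 0 1) := by
    simpa using integrable_gaussian_pow 1
  simp only [h]
  have h2 : Integrable (fun x : ℝ => (x * max x 0 ^ 2 - x ^ 3) / 2) (gaussianReal 0 1) :=
    (integrable_gaussian_mul_max_sq.sub (integrable_gaussian_pow 3)).div_const 2
  rw [integral_add h2 h1, integral_div, integral_sub integrable_gaussian_mul_max_sq (integrable_gaussian_pow 3),
    integral_gaussian_cube, integral_gaussian_mul_max_sq, integral_id_gaussianReal]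
  ring

/-! ### The two processes -/

lemma eight_mul_inv_sqrt : 8 * (Real.sqrt (2 * Real.pi))⁻¹ = Real.sqrt (32 / Real.pi) := by
  rw [show 32 / Real.pi = 8 ^ 2 / (2 * Real.pi) by field_simp; norm_num,
    Real.sqrt_div (by positivity), Real.sqrt_sq (by norm_num), div_eq_mul_inv]

/-- The jump map of Forward Event-Chain Monte Carlo. -/
def jumpF (_ m : ℝ) : ℝ := -m

/-- The jump map of the Bouncy Particle Sampler. -/
def jumpB (x _ : ℝ) : ℝ := -x

lemma measurable_jumpF : Measurable (Function.uncurry jumpF) := measurable_snd.neg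

lemma measurable_jumpB : Measurable (Function.uncurry jumpB) := measurable_fst.neg

lemma jumpF_nonpos (y m : ℝ) (_ : 0 < y) (hm : 0 < m) : jumpF y m ≤ 0 := neg_nonpos.2 hm.le

lemma jumpB_nonpos (y m : ℝ) (hy : 0 < y) (_ : 0 < m) : jumpB y m ≤ 0 := neg_nonpos.2 hy.le

lemma landing_jumpF_sq (x : ℝ) (p : ℝ × ℝ) : landing jumpF x p ^ 2 = p.2 ^ 2 := by
  simp [landing, jumpF]

lemma landing_jumpB_sq (x : ℝ) {p : ℝ × ℝ} (hp : 0 < p.1) :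
    landing jumpB x p ^ 2 = max x 0 ^ 2 + 2 * p.1 := by
  rw [landing, jumpB, neg_sq, sq_peak x hp.le]

lemma integrable_noise_snd_sq : Integrable (fun p : ℝ × ℝ => p.2 ^ 2) noise := by
  have := isProbabilityMeasure_expMeasure one_pos
  exact integrable_rayleigh_sq.1.comp_snd _

lemma integral_noise_snd_sq : ∫ p : ℝ × ℝ, p.2 ^ 2 ∂noise = 2 := by
  have := isProbabilityMeasure_expMeasure one_pos
  rw [noise, integral_fun_snd (f := fun m : ℝ => m ^ 2), integrable_rayleigh_sq.2]
  simp

lemma integrable_landing_jumpF (x : ℝ) :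
    Integrable (fun p => landing jumpF x p ^ 2) noise := by
  simpa only [landing_jumpF_sq] using integrable_noise_snd_sq

lemma integrable_initialLaw_landing_jumpF :
    Integrable (fun q : ℝ × (ℝ × ℝ) => landing jumpF q.1 q.2 ^ 2) initialLaw := by
  simp only [landing_jumpF_sq]
  exact integrable_noise_snd_sq.comp_snd (gaussianReal 0 1)

lemma integrable_landing_jumpB (x : ℝ) :
    Integrable (fun p => landing jumpB x p ^ 2) noise := by
  refine ((integrable_const (max x 0 ^ 2)).add (integrable_noise_fst.const_mul 2)).congr ?_
  filter_upwards [ae_noise_pos] with p hp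
  exact (landing_jumpB_sq x hp.1).symm

lemma integrable_initialLaw_landing_jumpB :
    Integrable (fun q : ℝ × (ℝ × ℝ) => landing jumpB q.1 q.2 ^ 2) initialLaw := by
  have hx : Integrable (fun x : ℝ => max x 0 ^ 2) (gaussianReal 0 1) :=
    (integrable_gaussian_pow 2).mono' (by fun_prop) (Eventually.of_forall fun x => by
      rw [Real.norm_of_nonneg (sq_nonneg _)]
      exact max_zero_sq_le x)
  refine ((hx.comp_fst noise).add
    ((integrable_noise_fst.comp_snd (gaussianReal 0 1)).const_mul 2)).congr ?_
  filter_upwards [ae_initialLaw_pos] with q hq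
  exact (landing_jumpB_sq q.1 hq.1).symm

lemma tendsto_diffusivity_RF :
    Tendsto (diffusivity RF) (𝓝[>] 0) (𝓝 (Real.sqrt (32 / Real.pi))) := by
  have hx : Integrable (fun x : ℝ => |x|) (gaussianReal 0 1) := by
    simpa using (integrable_gaussian_pow 1).abs
  have h := tendsto_diffusivity_process integrable_noise_fst integral_noise_fst
    measurable_jumpF jumpF_nonpos (integrable_landing_jumpF 0)
    (by simpa only [landing_jumpF_sq] using integral_noise_snd_sq)
    integrable_initialLaw_landing_jumpF
    (by
      simp only [landing_jumpF_sq]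
      exact hx.mul_prod integrable_noise_snd_sq)
  -- The refreshed landing point is independent of `x`, so the integral factors through `E[x] = 0`.
  have h1 : ∫ q : ℝ × (ℝ × ℝ), q.1 * (1 - landing jumpF q.1 q.2 ^ 2 / 2) ∂initialLaw = 0 := by
    simp only [landing_jumpF_sq]
    rw [initialLaw, integral_prod_mul (fun x : ℝ => x) fun p : ℝ × ℝ => 1 - p.2 ^ 2 / 2,
      integral_id_gaussianReal, zero_mul]
  rw [integral_gaussian_stage_zero, h1, add_zero, eight_mul_inv_sqrt] at h
  exact h

lemma tendsto_diffusivity_RB : Tendsto (diffusivity RB) (𝓝[>] 0) (𝓝 0) := by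
  have hx : Integrable (fun x : ℝ => x) (gaussianReal 0 1) := by
    simpa using integrable_gaussian_pow 1
  have hxe : Integrable (fun q : ℝ × (ℝ × ℝ) => q.1 * q.2.1) initialLaw :=
    hx.mul_prod integrable_noise_fst
  have hE : ∫ p, landing jumpB 0 p ^ 2 ∂noise = 2 := by
    have : ∫ p, landing jumpB 0 p ^ 2 ∂noise = ∫ p : ℝ × ℝ, 2 * p.1 ∂noise := by
      refine integral_congr_ae ?_
      filter_upwards [ae_noise_pos] with p hp
      simp [landing_jumpB_sq 0 hp.1]
    rw [this, integral_const_mul, integral_noise_fst, mul_one]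
  have h3 : Integrable (fun q : ℝ × (ℝ × ℝ) => |q.1| * landing jumpB q.1 q.2 ^ 2)
      initialLaw := by
    refine ((integrable_gaussian_mul_max_sq.comp_fst noise).abs.add
      (hxe.abs.const_mul 2)).congr ?_
    filter_upwards [ae_initialLaw_pos] with q hq
    rw [landing_jumpB_sq q.1 hq.1]
    simp only [Pi.add_apply, abs_mul, abs_pow, sq_abs, abs_of_pos hq.1]
    ring
  have h := tendsto_diffusivity_process integrable_noise_fst integral_noise_fst
    measurable_jumpB jumpB_nonpos (integrable_landing_jumpB 0) hE
    integrable_initialLaw_landing_jumpB h3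
  -- Reflection remembers `x₊²`: the term `-E[x x₊²] / 2` cancels the initial stage exactly.
  have h1 : ∫ q : ℝ × (ℝ × ℝ), q.1 * (1 - landing jumpB q.1 q.2 ^ 2 / 2) ∂initialLaw =
      -(Real.sqrt (2 * Real.pi))⁻¹ := by
    have heq : ∫ q : ℝ × (ℝ × ℝ), q.1 * (1 - landing jumpB q.1 q.2 ^ 2 / 2) ∂initialLaw =
        ∫ q : ℝ × (ℝ × ℝ), (q.1 - q.1 * max q.1 0 ^ 2 / 2 - q.1 * q.2.1) ∂initialLaw := by
      refine integral_congr_ae ?_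
      filter_upwards [ae_initialLaw_pos] with q hq
      rw [landing_jumpB_sq q.1 hq.1]
      ring
    have hmax := integrable_gaussian_mul_max_sq.div_const 2
    have hfst : Integrable (fun q : ℝ × (ℝ × ℝ) => q.1 - q.1 * max q.1 0 ^ 2 / 2) initialLaw :=
      (hx.sub hmax).comp_fst noise
    rw [heq, integral_sub hfst hxe, initialLaw,
      integral_fun_fst (f := fun x : ℝ => x - x * max x 0 ^ 2 / 2), integral_sub hx hmax,
      integral_prod_mul (fun x : ℝ => x) fun p : ℝ × ℝ => p.1, integral_div,
      integral_gaussian_mul_max_sq, integral_id_gaussianReal, probReal_univ, one_smul]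
    ring
  rw [integral_gaussian_stage_zero, h1, add_neg_cancel, mul_zero] at h
  exact h

end

end RadialMomentum

end

theorem corollary4p2 :
    -- the covariance functions and the integrals that define the two coefficients make sense
    (∀ t : ℝ, 0 ≤ t → MemLp (RadialMomentum.RF t) 2 RadialMomentum.prob ∧
      MemLp (RadialMomentum.RB t) 2 RadialMomentum.prob) ∧
    (∀ ρ : ℝ, 0 < ρ →
      IntegrableOn (fun t => Real.exp (-ρ * t) * RadialMomentum.covFun RadialMomentum.RF t 0)
        (Set.Ioi 0) volume ∧
      IntegrableOn (fun t => Real.exp (-ρ * t) * RadialMomentum.covFun RadialMomentum.RB t 0)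
        (Set.Ioi 0) volume) ∧
    -- the two limits
    Tendsto RadialMomentum.sigmaFSq (𝓝[>] 0) (𝓝 (Real.sqrt (32 / Real.pi))) ∧
    Tendsto RadialMomentum.sigmaBSq (𝓝[>] 0) (𝓝 0) := by
  open RadialMomentum in
  exact ⟨fun t ht => ⟨memLp_process measurable_jumpF jumpF_nonpos (integrable_landing_jumpF 0)
        integrable_initialLaw_landing_jumpF ht,
      memLp_process measurable_jumpB jumpB_nonpos (integrable_landing_jumpB 0)
        integrable_initialLaw_landing_jumpB ht⟩,
    fun ρ hρ => ⟨integrableOn_discounted_covFun measurable_jumpF jumpF_nonpos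
        (integrable_landing_jumpF 0) integrable_initialLaw_landing_jumpF hρ,
      integrableOn_discounted_covFun measurable_jumpB jumpB_nonpos
        (integrable_landing_jumpB 0) integrable_initialLaw_landing_jumpB hρ⟩,
    tendsto_diffusivity_RF, tendsto_diffusivity_RB⟩
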